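/- \textbf{Theorem 8.} \emph{Setting.} Let $X\subset\mathbb R^{d_1}$ be closed and convex. In round $t=1,\dots,T$ an outer objective $f_t$ and an inner objective $g_t$, both real functions on $X\times\mathbb R^{d_2}$, are revealed. Put $y_t^*(x)=\arg\min_{y\in\mathbb R^{d_2}} g_t(x,y)$ and $F_t(x)=f_t(x,y_t^*(x))$. Let $\mu_g>0$, $L_{f,0},L_{f,1},L_{g,1},L_{g,2}\ge 0$ and $Q>0$, and assume for every $t\in[T]$: $f_t$ is differentiable; $g_t(x,\cdot)$ is differentiable and $\mu_g$-strongly convex for each $x\in X$; $\nabla_y g_t$ is differentiable in $(x,y)$; on $X\times\mathbb R^{d_2}$, $f_t$ is $L_{f,0}$-Lipschitz, $\nabla f_t=(\nabla_x f_t,\nabla_y f_t)$ is $L_{f,1}$-Lipschitz, $\nabla_y g_t$ is $L_{g,1}$-Lipschitz, and $\nabla_{xy}^2 g_t$ (the $d_1\times d_2$ transposed Jacobian of $\nabla_y g_t$ in $x$) and $\nabla_{yy}^2 g_t$ are $L_{g,2}$-Lipschitz in operator norm; and $|F_t(x)|\le Q$ for all $x\in X$. \emph{Algorithm (noise-free SOGD,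 constant parameters).} Write $q_t^y=\nabla_y g_t(x_t,y_t)$, $q_t^v=\nabla_{yy}^2 g_t(x_t,y_t)v_t-\nabla_y f_t(x_t,y_t)$, $q_t^x=\nabla_x f_t(x_t,y_t)-\nabla_{xy}^2 g_t(x_t,y_t)v_t$. From $x_1\in X$, $y_1,v_1\in\mathbb R^{d_2}$ the search directions are $d_1^{\bullet}=q_1^{\bullet}$ and, for $2\le t\le T$, $$d_t^y=q_t^y+(1-\gamma)(d_{t-1}^y-q_{t-1}^y),\quad d_t^v=q_t^v+(1-\lambda)(d_{t-1}^v-q_{t-1}^v),\quad d_t^x=q_t^x+(1-\eta)(d_{t-1}^x-q_{t-1}^x),$$ and, for $1\le t\le T$, the three variables are updated simultaneously by $$y_{t+1}=y_t-\beta d_t^y,\quad v_{t+1}=\mathcal P_{\{\|v\|\le L_{f,0}/\mu_g\}}(v_t-\delta d_t^v),\quad x_{t+1}=\arg\min_{u\in X}\Big\{\langle d_t^x,u\rangle+\tfrac1{2\alpha}\|u-x_t\|^2\Big\}.$$ \emph{Quantities.} Let $\mathcal G_X(x,g,\alpha)=\frac1\alpha(x-x^+)$ with $x^+=\arg\min_{u\in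 X}\{\langle g,u\rangle+\frac1{2\alpha}\|u-x\|^2\}$, and $\mathrm{Reg}(T)=\sum_{t=1}^T\|\mathcal G_X(x_t,\nabla F_t(x_t),\alpha)\|^2$. With suprema over $x\in X$, $y\in\mathbb R^{d_2}$ taken in $[0,\infty]$, let $$V_T=\sum_{t=2}^T\sup_x|F_{t-1}(x)-F_t(x)|,\qquad H_{2,T}=\sum_{t=2}^T\sup_x\|y_{t-1}^*(x)-y_t^*(x)\|^2,$$ $$E_{2,T}=\sum_{t=2}^T\sup_{x,y}\|\nabla_{yy}^2g_{t-1}(x,y)-\nabla_{yy}^2g_t(x,y)\|^2+\sum_{t=2}^T\sup_{x,y}\|\nabla_yf_{t-1}(x,y)-\nabla_yf_t(x,y)\|^2,$$ $$P_T=\sum_{t=2}^T\Big(\sup_{x,y}\|\nabla_xf_{t-1}(x,y)-\nabla_xf_t(x,y)\|^2+\|\nabla_yg_{t-1}(x_t,y_t)-\nabla_yg_t(x_t,y_t)\|^2+\|\nabla_{xy}^2g_{t-1}(x_t,y_t)-\nabla_{xy}^2g_t(x_t,y_t)\|^2\Big).$$ \emph{Claim.} There are positive constants $c_\beta,c_\delta,c_0$,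 depending only on $\mu_g,L_{f,0},L_{f,1},L_{g,1},L_{g,2}$, such that for all $c_\gamma,c_\lambda,c_\eta>0$ and all $c\ge c_0$, with the constant parameters $\alpha=1/c$, $\beta=c_\beta\alpha$, $\delta=c_\delta\alpha$, $\gamma=c_\gamma\alpha^2$, $\lambda=c_\lambda\alpha^2$, $\eta=c_\eta\alpha^2$, and for all $Q>0$ and $R\ge 0$, the following holds for some constant $C>0$ that does not depend on $d_1,d_2,X,T$, on the objectives, or on the run: whenever $\|y_1-y_1^*(x_1)\|\le R$ and $\|v_1\|\le R$, every $F_t$, $t\in[T]$, is differentiable on $X$ and $$\mathrm{Reg}(T)\le C\,(1+V_T+H_{2,T}+E_{2,T}+P_T).$$ -/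

import Mathlib

open scoped ENNReal

noncomputable section

namespace SOGD

/-- `d`-dimensional Euclidean space with the `ℓ²` norm. -/
abbrev Vec (d : ℕ) := EuclideanSpace ℝ (Fin d)

/-- The `ℓ²` norm of the stacked vector `(u, w)`. -/
def norm2 {d₁ d₂ : ℕ} (u : Vec d₁) (w : Vec d₂) : ℝ := Real.sqrt (‖u‖ ^ 2 + ‖w‖ ^ 2)

/-- The objectives `f`, `g` revealed in one round, with the derivatives that a first-order method
queries. That these functions are the derivatives is required in `Admissible`. -/
structure Round (d₁ d₂ : ℕ) where
  /-- outer objective `f(x, y)` -/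
  f : Vec d₁ → Vec d₂ → ℝ
  /-- inner objective `g(x, y)` -/
  g : Vec d₁ → Vec d₂ → ℝ
  /-- `∇ₓ f` -/
  fx : Vec d₁ → Vec d₂ → Vec d₁
  /-- `∇_y f` -/
  fy : Vec d₁ → Vec d₂ → Vec d₂
  /-- `∇_y g` -/
  gy : Vec d₁ → Vec d₂ → Vec d₂
  /-- `∇²_{xy} g`, a `d₁ × d₂` matrix: the transposed Jacobian of `∇_y g` in `x` -/
  gxy : Vec d₁ → Vec d₂ → (Vec d₂ →L[ℝ] Vec d₁)
  /-- `∇²_{yy} g` -/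
  gyy : Vec d₁ → Vec d₂ → (Vec d₂ →L[ℝ] Vec d₂)

namespace Round

variable {d₁ d₂ : ℕ}

/-- The inner solution `y*(x) = argmin_y g(x, y)` over the whole space. -/
def yStar (r : Round d₁ d₂) (x : Vec d₁) : Vec d₂ :=
  Classical.epsilon fun y => ∀ y', r.g x y ≤ r.g x y'

/-- The bilevel objective `F(x) = f(x, y*(x))`. -/
def F (r : Round d₁ d₂) (x : Vec d₁) : ℝ := r.f x (r.yStar x)

/-- The direction for the linear system: `∇_v Φ(x, y, v)`, where
`Φ(x, y, v) = ½ vᵀ ∇²_{yy} g(x, y) v - vᵀ ∇_y f(x, y)`. -/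
def dirV (r : Round d₁ d₂) (x : Vec d₁) (y v : Vec d₂) : Vec d₂ := r.gyy x y v - r.fy x y

/-- The approximate hypergradient `∇ₓ f(x, y) - ∇²_{xy} g(x, y) v`. -/
def dirX (r : Round d₁ d₂) (x : Vec d₁) (y v : Vec d₂) : Vec d₁ := r.fx x y - r.gxy x y v

/-- The standing assumptions on one round, for the domain `X × ℝ^{d₂}`. Derivatives are taken
within that domain. -/
structure Admissible (r : Round d₁ d₂) (X : Set (Vec d₁)) (μg Lf0 Lf1 Lg1 Lg2 Q : ℝ) : Prop where
  /-- `(∇ₓ f, ∇_y f)` is the gradient of `f` -/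
  hasDeriv_f : ∀ x ∈ X, ∀ y, HasFDerivWithinAt (fun z : Vec d₁ × Vec d₂ => r.f z.1 z.2)
    ((innerSL ℝ (r.fx x y)).comp (ContinuousLinearMap.fst ℝ (Vec d₁) (Vec d₂)) +
      (innerSL ℝ (r.fy x y)).comp (ContinuousLinearMap.snd ℝ (Vec d₁) (Vec d₂)))
    (X ×ˢ Set.univ) (x, y)
  /-- `∇_y g` is the gradient of `g` in `y` -/
  hasGrad_g : ∀ x ∈ X, ∀ y, HasGradientAt (fun y' => r.g x y') (r.gy x y) y
  /-- the derivative of `∇_y g` is given by `(∇²_{xy} g)ᵀ` and `∇²_{yy} g` -/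
  hasDeriv_gy : ∀ x ∈ X, ∀ y, HasFDerivWithinAt (fun z : Vec d₁ × Vec d₂ => r.gy z.1 z.2)
    ((ContinuousLinearMap.adjoint (r.gxy x y)).comp
        (ContinuousLinearMap.fst ℝ (Vec d₁) (Vec d₂)) +
      (r.gyy x y).comp (ContinuousLinearMap.snd ℝ (Vec d₁) (Vec d₂)))
    (X ×ˢ Set.univ) (x, y)
  /-- `g(x, ·)` is `μg`-strongly convex -/
  strongConvex : ∀ x ∈ X, StrongConvexOn Set.univ μg (fun y => r.g x y)
  /-- `f` is `Lf0`-Lipschitz -/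
  lip_f : ∀ x ∈ X, ∀ x' ∈ X, ∀ y y',
    |r.f x y - r.f x' y'| ≤ Lf0 * norm2 (x - x') (y - y')
  /-- `∇f` is `Lf1`-Lipschitz -/
  lip_grad_f : ∀ x ∈ X, ∀ x' ∈ X, ∀ y y',
    norm2 (r.fx x y - r.fx x' y') (r.fy x y - r.fy x' y') ≤ Lf1 * norm2 (x - x') (y - y')
  /-- `∇_y g` is `Lg1`-Lipschitz -/
  lip_gy : ∀ x ∈ X, ∀ x' ∈ X, ∀ y y',
    ‖r.gy x y - r.gy x' y'‖ ≤ Lg1 * norm2 (x - x') (y - y')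
  /-- `∇²_{xy} g` is `Lg2`-Lipschitz -/
  lip_gxy : ∀ x ∈ X, ∀ x' ∈ X, ∀ y y',
    ‖r.gxy x y - r.gxy x' y'‖ ≤ Lg2 * norm2 (x - x') (y - y')
  /-- `∇²_{yy} g` is `Lg2`-Lipschitz -/
  lip_gyy : ∀ x ∈ X, ∀ x' ∈ X, ∀ y y',
    ‖r.gyy x y - r.gyy x' y'‖ ≤ Lg2 * norm2 (x - x') (y - y')
  /-- `|F| ≤ Q` on `X` -/
  bounded_F : ∀ x ∈ X, |r.F x| ≤ Q

end Round

variable {d₁ d₂ : ℕ}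

/-- `x⁺ = argmin_{u ∈ X} ⟨G, u⟩ + ‖u - x‖² / (2 s)`, that is, the projection of `x - s G` on `X`. -/
def proxStep (X : Set (Vec d₁)) (x G : Vec d₁) (s : ℝ) : Vec d₁ :=
  Classical.epsilon fun u => u ∈ X ∧ ∀ u' ∈ X,
    inner ℝ G u + 1 / (2 * s) * ‖u - x‖ ^ 2 ≤ inner ℝ G u' + 1 / (2 * s) * ‖u' - x‖ ^ 2

/-- The gradient mapping `𝒢_X(x, G, s) = (x - x⁺) / s`. -/
def gradMap (X : Set (Vec d₁)) (x G : Vec d₁) (s : ℝ) : Vec d₁ :=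
  (1 / s) • (x - proxStep X x G s)

/-- Euclidean projection on the closed ball of radius `p` about the origin. -/
def projBall (p : ℝ) (v : Vec d₂) : Vec d₂ :=
  Classical.epsilon fun u => ‖u‖ ≤ p ∧ ∀ u' : Vec d₂, ‖u'‖ ≤ p → ‖v - u‖ ≤ ‖v - u'‖

/-- The sequences of a noise-free run of SOGD over rounds `1, …, T` with constant step sizes
`α` (outer), `β` (inner), `δ` (linear system) and constant momentum parameters `γ` (inner),
`lam` (linear system), `η` (outer); `p` is the radius of the ball that the `v`-iterates are
projected to. All three search directions are momentum-corrected (recursive) estimates, and the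
three variables are updated simultaneously. -/
structure IsRun (X : Set (Vec d₁)) (p α β δ γ lam η : ℝ) (P : ℕ → Round d₁ d₂) (T : ℕ)
    (x : ℕ → Vec d₁) (y v : ℕ → Vec d₂) (dx : ℕ → Vec d₁) (dy dv : ℕ → Vec d₂) : Prop where
  x_init : x 1 ∈ X
  dy_init : dy 1 = (P 1).gy (x 1) (y 1)
  dv_init : dv 1 = (P 1).dirV (x 1) (y 1) (v 1)
  dx_init : dx 1 = (P 1).dirX (x 1) (y 1) (v 1)
  dy_step : ∀ t ∈ Finset.Icc 2 T, dy t = (P t).gy (x t) (y t) +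
    (1 - γ) • (dy (t - 1) - (P (t - 1)).gy (x (t - 1)) (y (t - 1)))
  dv_step : ∀ t ∈ Finset.Icc 2 T, dv t = (P t).dirV (x t) (y t) (v t) +
    (1 - lam) • (dv (t - 1) - (P (t - 1)).dirV (x (t - 1)) (y (t - 1)) (v (t - 1)))
  dx_step : ∀ t ∈ Finset.Icc 2 T, dx t = (P t).dirX (x t) (y t) (v t) +
    (1 - η) • (dx (t - 1) - (P (t - 1)).dirX (x (t - 1)) (y (t - 1)) (v (t - 1)))
  y_step : ∀ t ∈ Finset.Icc 1 T, y (t + 1) = y t - β • dy t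
  v_step : ∀ t ∈ Finset.Icc 1 T, v (t + 1) = projBall p (v t - δ • dv t)
  x_step : ∀ t ∈ Finset.Icc 1 T, x (t + 1) = proxStep X (x t) (dx t) α

/-- The bilevel local regret `∑_{t=1}^T ‖𝒢_X(x_t, ∇F_t(x_t), s)‖²`; `∇F_t` is the total derivative
of `x ↦ f_t(x, y_t*(x))` within `X`. -/
def regret (X : Set (Vec d₁)) (P : ℕ → Round d₁ d₂) (T : ℕ) (x : ℕ → Vec d₁) (s : ℝ) : ℝ :=
  ∑ t ∈ Finset.Icc 1 T, ‖gradMap X (x t) (gradientWithin (P t).F X (x t)) s‖ ^ 2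

/-! Variation measures. Suprema are taken in `[0, ∞]`. -/

/-- `V_T = ∑_{t=2}^T sup_{x ∈ X} |F_{t-1}(x) - F_t(x)|` -/
def varV (X : Set (Vec d₁)) (P : ℕ → Round d₁ d₂) (T : ℕ) : ℝ≥0∞ :=
  ∑ t ∈ Finset.Icc 2 T, ⨆ x ∈ X, ‖(P (t - 1)).F x - (P t).F x‖ₑ

/-- `H_{2,T} = ∑_{t=2}^T sup_{x ∈ X} ‖y*_{t-1}(x) - y*_t(x)‖²` -/
def varH2 (X : Set (Vec d₁)) (P : ℕ → Round d₁ d₂) (T : ℕ) : ℝ≥0∞ :=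
  ∑ t ∈ Finset.Icc 2 T, ⨆ x ∈ X, ‖(P (t - 1)).yStar x - (P t).yStar x‖ₑ ^ 2

/-- `E_{2,T} = ∑_{t=2}^T sup_{x,y} ‖∇²_{yy} g_{t-1} - ∇²_{yy} g_t‖²
  + ∑_{t=2}^T sup_{x,y} ‖∇_y f_{t-1} - ∇_y f_t‖²` -/
def varE2 (X : Set (Vec d₁)) (P : ℕ → Round d₁ d₂) (T : ℕ) : ℝ≥0∞ :=
  (∑ t ∈ Finset.Icc 2 T, ⨆ x ∈ X, ⨆ y, ‖(P (t - 1)).gyy x y - (P t).gyy x y‖ₑ ^ 2) +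
  ∑ t ∈ Finset.Icc 2 T, ⨆ x ∈ X, ⨆ y, ‖(P (t - 1)).fy x y - (P t).fy x y‖ₑ ^ 2

/-- `D_{x,T} = ∑_{t=2}^T sup_{x,y} ‖∇ₓ f_{t-1} - ∇ₓ f_t‖²` -/
def varDx (X : Set (Vec d₁)) (P : ℕ → Round d₁ d₂) (T : ℕ) : ℝ≥0∞ :=
  ∑ t ∈ Finset.Icc 2 T, ⨆ x ∈ X, ⨆ y, ‖(P (t - 1)).fx x y - (P t).fx x y‖ₑ ^ 2

/-- `G_{y,T} = ∑_{t=2}^T ‖∇_y g_{t-1}(x_t, y_t) - ∇_y g_t(x_t, y_t)‖²` -/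
def varGy (P : ℕ → Round d₁ d₂) (T : ℕ) (x : ℕ → Vec d₁) (y : ℕ → Vec d₂) : ℝ≥0∞ :=
  ∑ t ∈ Finset.Icc 2 T, ‖(P (t - 1)).gy (x t) (y t) - (P t).gy (x t) (y t)‖ₑ ^ 2

/-- `G_{xy,T} = ∑_{t=2}^T ‖∇²_{xy} g_{t-1}(x_t, y_t) - ∇²_{xy} g_t(x_t, y_t)‖²` -/
def varGxy (P : ℕ → Round d₁ d₂) (T : ℕ) (x : ℕ → Vec d₁) (y : ℕ → Vec d₂) : ℝ≥0∞ :=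
  ∑ t ∈ Finset.Icc 2 T, ‖(P (t - 1)).gxy (x t) (y t) - (P t).gxy (x t) (y t)‖ₑ ^ 2

/-- `P_T = D_{x,T} + G_{y,T} + G_{xy,T}` -/
def varP (X : Set (Vec d₁)) (P : ℕ → Round d₁ d₂) (T : ℕ) (x : ℕ → Vec d₁) (y : ℕ → Vec d₂) :
    ℝ≥0∞ :=
  varDx X P T + varGy P T x y + varGxy P T x y

end SOGD

end

/-!
The momentum corrections `d - q` start at `0` and are only multiplied by `1 - γ`, `1 - λ`, `1 - η`,
so in the absence of noise they vanish identically (`SOGD.IsRun.step`), and the algorithm is a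
simultaneous descent on `y`, `v` and `x` with step sizes `κ α`, `κ α` and `α`.

Let `a t = ‖y t - y*_t(x t)‖`, `w t = ‖v t - v*_t(x t)‖` and `D t = ‖x (t + 1) - x t‖`. Strong
convexity makes the inner steps contract with rate `1 - κ α μ / 2`, and `y*`, `v*` are Lipschitz, so
`a` and `w` satisfy linear recursions driven by `D` and by the variations of `y*` and `v*`
(`norm_step_y_sub_le`, `norm_step_v_sub_le`). Summing squares,
`∑ (a² + w²) ≲ 1 / α + (∑ D²) / (κ α)² + variations`. The estimate `dirX` of the hypergradient has a
bias of order `a + w`, and the descent lemma for `F` gives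
`F_t(x (t + 1)) ≤ F_t(x t) - D² / (2 α) + α O(a² + w²)` (`F_proxStep_le`). For `κ` large, depending
only on the problem constants, the `D²`-part of the tracking errors is absorbed, and telescoping
bounds `∑ D² / α²` and hence the regret (`exists_ratio_sum_sq_le`).

Since `X` may have empty interior, `∇²_{xy} g` and the gradient of `F` within `X` are under control
only when paired with differences of points of `X`. This is all that the proximal step uses
(`norm_proxStep_sub_le`), so every estimate on `x`-gradients is stated in that weak form; the bound on
`∇²_{xy} g` is `abs_inner_gxy_le`, and `inner_gradientWithin_F` shows that the choice made by
`gradientWithin` does not matter. The differentiability of `F` (`hasGradientWithinAt_F`) comes from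
freezing the multiplier `v*` in a Lagrangian, which avoids differentiating `y*`.
-/

/-! ### Convex analysis in a Hilbert space -/

section ConvexAnalysis

open Set Filter Topology

variable {E : Type*} [NormedAddCommGroup E] [InnerProductSpace ℝ E]

theorem StrongConvexOn.add_inner_add_le [CompleteSpace E] {m : ℝ} {φ : E → ℝ} {G y : E}
    (hφ : StrongConvexOn univ m φ) (hG : HasGradientAt φ G y) (z : E) :
    φ y + inner ℝ G (z - y) + m / 2 * ‖z - y‖ ^ 2 ≤ φ z := by
  have h1 : HasDerivAt (fun s : ℝ => φ (y + s • (z - y))) (inner ℝ G (z - y)) 0 := by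
    have := hG.hasFDerivAt.hasLineDerivAt (z - y)
    simpa [HasLineDerivAt] using this
  have h2 := (hasDerivWithinAt_iff_tendsto_slope' (s := Ioi (0 : ℝ)) (by simp)).1
    h1.hasDerivWithinAt
  have h3 : Tendsto (fun s : ℝ => φ z - φ y - (1 - s) * (m / 2 * ‖z - y‖ ^ 2)) (𝓝[>] 0)
      (𝓝 (φ z - φ y - (1 - 0) * (m / 2 * ‖z - y‖ ^ 2))) := by
    have : Continuous (fun s : ℝ => φ z - φ y - (1 - s) * (m / 2 * ‖z - y‖ ^ 2)) := by fun_prop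
    exact (this.tendsto 0).mono_left nhdsWithin_le_nhds
  have h4 := le_of_tendsto_of_tendsto h2 h3 (by
    filter_upwards [Ioc_mem_nhdsGT (zero_lt_one' ℝ)] with s hs
    have h5 := hφ.2 (mem_univ z) (mem_univ y) hs.1.le (sub_nonneg.2 hs.2) (by ring)
    have h6 : s • z + (1 - s) • y = y + s • (z - y) := by module
    rw [h6] at h5
    simp only [smul_eq_mul] at h5
    rw [slope_def_field, zero_smul, add_zero, sub_zero, div_le_iff₀ hs.1]
    linarith)
  linarith

theorem StrongConvexOn.mul_norm_sq_le_inner [CompleteSpace E] {m : ℝ} {φ : E → ℝ} {G : E → E}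
    (hφ : StrongConvexOn univ m φ) (hG : ∀ y, HasGradientAt φ (G y) y) (y z : E) :
    m * ‖y - z‖ ^ 2 ≤ inner ℝ (G y - G z) (y - z) := by
  have h1 := hφ.add_inner_add_le (hG y) z
  have h2 := hφ.add_inner_add_le (hG z) y
  rw [← neg_sub y z, inner_neg_right, norm_neg] at h1
  rw [inner_sub_left]
  linarith

theorem StrongConvexOn.exists_isMin [ProperSpace E] {m : ℝ} (hm : 0 < m)
    {φ : E → ℝ} {G : E → E}
    (hφ : StrongConvexOn univ m φ) (hG : ∀ y, HasGradientAt φ (G y) y) :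
    ∃ y, ∀ z, φ y ≤ φ z := by
  have hc : Continuous φ := continuous_iff_continuousAt.2 fun y => (hG y).hasFDerivAt.continuousAt
  refine hc.exists_forall_le' 0 ?_
  filter_upwards [(tendsto_norm_cocompact_atTop (E := E)).eventually_ge_atTop (2 / m * ‖G 0‖)]
    with z hz
  have h1 := hφ.add_inner_add_le (hG 0) z
  rw [sub_zero] at h1
  have h2 := neg_le_of_abs_le (abs_real_inner_le_norm (G 0) z)
  have h3 : ‖G 0‖ ≤ m / 2 * ‖z‖ := by
    calc ‖G 0‖ = m / 2 * (2 / m * ‖G 0‖) := by field_simp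
      _ ≤ _ := by gcongr
  have h4 := mul_le_mul_of_nonneg_right h3 (norm_nonneg z)
  nlinarith

theorem mul_norm_le_of_mul_norm_sq_le_inner {m : ℝ} {e D : E}
    (h : m * ‖e‖ ^ 2 ≤ inner ℝ D e) : m * ‖e‖ ≤ ‖D‖ := by
  rcases (norm_nonneg e).eq_or_lt with h0 | h0
  · simp [← h0]
  · have := h.trans (real_inner_le_norm D e)
    exact le_of_mul_le_mul_right (by linarith) h0

/-- One gradient step contracts the distance to the stationary point. -/
theorem norm_sub_smul_le {m L s : ℝ} {e D : E} (h : m * ‖e‖ ^ 2 ≤ inner ℝ D e)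
    (hD : ‖D‖ ≤ L * ‖e‖) (hs : 0 ≤ s) (hsL : s * L ^ 2 ≤ m) (hsm : s * m ≤ 1) :
    ‖e - s • D‖ ≤ (1 - s * m / 2) * ‖e‖ := by
  have h1 : ‖e - s • D‖ ^ 2 = ‖e‖ ^ 2 - 2 * s * inner ℝ D e + s ^ 2 * ‖D‖ ^ 2 := by
    rw [norm_sub_sq_real, inner_smul_right, norm_smul, Real.norm_of_nonneg hs,
      real_inner_comm]
    ring
  have h2 : ‖D‖ ^ 2 ≤ L ^ 2 * ‖e‖ ^ 2 := by
    rw [← mul_pow]; gcongr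
  have h3 : s ^ 2 * ‖D‖ ^ 2 ≤ s * m * ‖e‖ ^ 2 := by
    calc s ^ 2 * ‖D‖ ^ 2 ≤ s ^ 2 * (L ^ 2 * ‖e‖ ^ 2) := by gcongr
      _ = s * (s * L ^ 2) * ‖e‖ ^ 2 := by ring
      _ ≤ _ := by gcongr
  have h4 := mul_le_mul_of_nonneg_left h hs
  refine abs_le_of_sq_le_sq' ?_ (mul_nonneg (by linarith) (norm_nonneg _)) |>.2
  rw [h1]
  nlinarith [mul_nonneg (sq_nonneg (s * m)) (sq_nonneg ‖e‖)]

theorem surjective_of_mul_norm_sq_le_inner [FiniteDimensional ℝ E] {m : ℝ} (hm : 0 < m)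
    {A : E →L[ℝ] E} (h : ∀ w, m * ‖w‖ ^ 2 ≤ inner ℝ (A w) w) : Function.Surjective A := by
  refine (LinearMap.injective_iff_surjective (f := (A : E →ₗ[ℝ] E))).1 ?_
  refine (injective_iff_map_eq_zero _).2 fun w hw => ?_
  have h1 := mul_norm_le_of_mul_norm_sq_le_inner (h w)
  have hw' : A w = 0 := hw
  rw [hw', norm_zero] at h1
  exact norm_le_zero_iff.1 (nonpos_of_mul_nonpos_right h1 hm)

end ConvexAnalysis

/-! ### Proximal steps and projections -/

namespace SOGD

variable {d₁ d₂ : ℕ}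

/-- The variational inequality that characterizes a proximal step. -/
theorem proxStep_spec {X : Set (Vec d₁)} (hX : IsClosed X) (hc : Convex ℝ X) {x : Vec d₁}
    (hx : x ∈ X) (G : Vec d₁) {s : ℝ} (hs : 0 < s) :
    proxStep X x G s ∈ X ∧
      ∀ w ∈ X, 0 ≤ inner ℝ (s • G + (proxStep X x G s - x)) (w - proxStep X x G s) := by
  obtain ⟨p, hpX, hp⟩ := exists_norm_eq_iInf_of_complete_convex ⟨x, hx⟩ hX.isComplete hc (x - s • G)
  rw [norm_eq_iInf_iff_real_inner_le_zero hc hpX] at hp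
  have hvi : ∀ w ∈ X, 0 ≤ inner ℝ (s • G + (p - x)) (w - p) := fun w hw => by
    have h1 := hp w hw
    have h2 : x - s • G - p = -(s • G + (p - x)) := by abel
    rw [h2, inner_neg_left] at h1
    linarith
  -- the objective minus its value at `p`, up to the factor `s`
  have hexp : ∀ w, s * ((inner ℝ G w + 1 / (2 * s) * ‖w - x‖ ^ 2) -
      (inner ℝ G p + 1 / (2 * s) * ‖p - x‖ ^ 2)) =
      inner ℝ (s • G + (p - x)) (w - p) + ‖w - p‖ ^ 2 / 2 := fun w => by
    have h1 : ‖w - x‖ ^ 2 = ‖w - p‖ ^ 2 + 2 * inner ℝ (p - x) (w - p) + ‖p - x‖ ^ 2 := by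
      rw [← sub_add_sub_cancel w p x, norm_add_sq_real, real_inner_comm]
    rw [h1, inner_add_left, inner_smul_left, inner_sub_right G]
    simp only [conj_trivial]
    field_simp
    ring
  have hex : ∃ u, u ∈ X ∧ ∀ u' ∈ X,
      inner ℝ G u + 1 / (2 * s) * ‖u - x‖ ^ 2 ≤ inner ℝ G u' + 1 / (2 * s) * ‖u' - x‖ ^ 2 := by
    refine ⟨p, hpX, fun w hw => ?_⟩
    have h1 := hexp w
    have h2 := hvi w hw
    have : 0 ≤ s * ((inner ℝ G w + 1 / (2 * s) * ‖w - x‖ ^ 2) -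
      (inner ℝ G p + 1 / (2 * s) * ‖p - x‖ ^ 2)) := by rw [h1]; positivity
    linarith [nonneg_of_mul_nonneg_right this hs]
  obtain ⟨hq, hmin⟩ := Classical.epsilon_spec hex
  have heq : proxStep X x G s = p := by
    have h1 := hexp (proxStep X x G s)
    have h2 := hvi _ hq
    have h3 := mul_nonneg hs.le (sub_nonneg.2 (hmin p hpX))
    have h4 : ‖proxStep X x G s - p‖ ^ 2 ≤ 0 := by
      unfold proxStep at h1 ⊢
      nlinarith
    exact sub_eq_zero.1 (norm_eq_zero.1 (pow_eq_zero_iff two_ne_zero |>.1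
      (le_antisymm h4 (sq_nonneg _))))
  rw [heq]
  exact ⟨hpX, hvi⟩

/-- A proximal step feels a change of the gradient only through its pairing with differences of
feasible points. -/
theorem norm_proxStep_sub_le {X : Set (Vec d₁)} (hX : IsClosed X) (hc : Convex ℝ X) {x : Vec d₁}
    (hx : x ∈ X) {G G' : Vec d₁} {s b : ℝ} (hs : 0 < s) (hb0 : 0 ≤ b)
    (hb : ∀ u ∈ X, ∀ u' ∈ X, |inner ℝ (G - G') (u - u')| ≤ b * ‖u - u'‖) :
    ‖proxStep X x G s - proxStep X x G' s‖ ≤ s * b := by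
  obtain ⟨hp, hvi⟩ := proxStep_spec hX hc hx G hs
  obtain ⟨hp', hvi'⟩ := proxStep_spec hX hc hx G' hs
  set p := proxStep X x G s
  set q := proxStep X x G' s
  have h1 := hvi q hp'
  have h2 := hvi' p hp
  have h3 := neg_le_of_abs_le (hb p hp q hp')
  have h4 : inner ℝ (s • G + (p - x)) (q - p) + inner ℝ (s • G' + (q - x)) (p - q) =
      - (s * inner ℝ (G - G') (p - q)) - ‖p - q‖ ^ 2 := by
    rw [← neg_sub p q, inner_neg_right, ← real_inner_self_eq_norm_sq]
    simp only [inner_add_left, inner_sub_left, inner_smul_left, conj_trivial]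
    ring
  have h5 : ‖p - q‖ * ‖p - q‖ ≤ s * b * ‖p - q‖ := by nlinarith
  rcases (norm_nonneg (p - q)).eq_or_lt with h0 | h0
  · rw [← h0]; positivity
  · exact le_of_mul_le_mul_right h5 h0

theorem projBall_spec {p : ℝ} (hp : 0 ≤ p) (v : Vec d₂) :
    ‖projBall p v‖ ≤ p ∧ ∀ w : Vec d₂, ‖w‖ ≤ p → ‖projBall p v - w‖ ≤ ‖v - w‖ := by
  have hc : Convex ℝ (Metric.closedBall (0 : Vec d₂) p) := convex_closedBall _ _
  have hne : (Metric.closedBall (0 : Vec d₂) p).Nonempty := ⟨0, by simpa using hp⟩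
  have hex : ∃ u : Vec d₂, ‖u‖ ≤ p ∧ ∀ u' : Vec d₂, ‖u'‖ ≤ p → ‖v - u‖ ≤ ‖v - u'‖ := by
    obtain ⟨u, hu, h⟩ := exists_norm_eq_iInf_of_complete_convex hne
      Metric.isClosed_closedBall.isComplete hc v
    refine ⟨u, by simpa using hu, fun u' hu' => h.le.trans ?_⟩
    exact ciInf_le ⟨0, Set.forall_mem_range.2 fun _ => norm_nonneg _⟩
      (⟨u', by simpa using hu'⟩ : Metric.closedBall (0 : Vec d₂) p)
  obtain ⟨hu, hmin⟩ := Classical.epsilon_spec hex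
  change ‖projBall p v‖ ≤ p at hu
  change ∀ u' : Vec d₂, ‖u'‖ ≤ p → ‖v - projBall p v‖ ≤ ‖v - u'‖ at hmin
  refine ⟨hu, fun w hw => ?_⟩
  have hu' : projBall p v ∈ Metric.closedBall (0 : Vec d₂) p := by simpa using hu
  have hvi := (norm_eq_iInf_iff_real_inner_le_zero hc (u := v) hu').1 (by
    have : Nonempty (Metric.closedBall (0 : Vec d₂) p) := hne.to_subtype
    refine le_antisymm (le_ciInf fun w => hmin _ (mem_closedBall_zero_iff.1 w.2)) ?_
    exact ciInf_le ⟨0, Set.forall_mem_range.2 fun _ => norm_nonneg _⟩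
      (⟨_, hu'⟩ : Metric.closedBall (0 : Vec d₂) p)) w (by simpa using hw)
  set u := projBall p v
  have h1 : ‖v - w‖ ^ 2 = ‖v - u‖ ^ 2 - 2 * inner ℝ (v - u) (w - u) + ‖u - w‖ ^ 2 := by
    rw [← sub_sub_sub_cancel_right v w u, norm_sub_sq_real, ← norm_sub_rev w u]
  refine abs_le_of_sq_le_sq' ?_ (norm_nonneg _) |>.2
  nlinarith [sq_nonneg ‖v - u‖]

end SOGD

/-! ### The hypergradient of one round -/

namespace SOGD

open Set Filter Topology

variable {d₁ d₂ : ℕ}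

theorem norm2_zero_left (w : Vec d₂) : norm2 (0 : Vec d₁) w = ‖w‖ := by
  simp [norm2]

theorem norm2_zero_right (u : Vec d₁) : norm2 u (0 : Vec d₂) = ‖u‖ := by
  simp [norm2]

theorem norm_le_norm2_left (u : Vec d₁) (w : Vec d₂) : ‖u‖ ≤ norm2 u w :=
  Real.le_sqrt_of_sq_le (by nlinarith [sq_nonneg ‖w‖])

theorem norm_le_norm2_right (u : Vec d₁) (w : Vec d₂) : ‖w‖ ≤ norm2 u w :=
  Real.le_sqrt_of_sq_le (by nlinarith [sq_nonneg ‖u‖])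

theorem norm2_le_add (u : Vec d₁) (w : Vec d₂) : norm2 u w ≤ ‖u‖ + ‖w‖ :=
  Real.sqrt_le_iff.2 ⟨by positivity, by nlinarith [norm_nonneg u, norm_nonneg w]⟩

namespace Round

/-- The exact solution `v*(x)` of the linear system `∇²_{yy} g(x, y*(x)) v = ∇_y f(x, y*(x))`. -/
noncomputable def vStar (r : Round d₁ d₂) (x : Vec d₁) : Vec d₂ :=
  Classical.epsilon fun v => r.gyy x (r.yStar x) v = r.fy x (r.yStar x)

/-- The hypergradient `∇ₓ f(x, y*) - ∇²_{xy} g(x, y*) v*` at `y* = y*(x)`, `v* = v*(x)`. -/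
noncomputable def hyperGrad (r : Round d₁ d₂) (x : Vec d₁) : Vec d₁ := r.dirX x (r.yStar x) (r.vStar x)

namespace Admissible

variable {r : Round d₁ d₂} {X : Set (Vec d₁)} {μ Lf0 Lf1 Lg1 Lg2 Q : ℝ}

theorem mul_norm_sq_le_inner_gy (h : r.Admissible X μ Lf0 Lf1 Lg1 Lg2 Q) {x : Vec d₁}
    (hx : x ∈ X) (y z : Vec d₂) :
    μ * ‖y - z‖ ^ 2 ≤ inner ℝ (r.gy x y - r.gy x z) (y - z) :=
  (h.strongConvex x hx).mul_norm_sq_le_inner (h.hasGrad_g x hx) y z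

theorem norm_gy_sub_le (h : r.Admissible X μ Lf0 Lf1 Lg1 Lg2 Q) {x : Vec d₁}
    (hx : x ∈ X) (y z : Vec d₂) : ‖r.gy x y - r.gy x z‖ ≤ Lg1 * ‖y - z‖ := by
  simpa [norm2_zero_left] using h.lip_gy x hx x hx y z

theorem gy_yStar (h : r.Admissible X μ Lf0 Lf1 Lg1 Lg2 Q) (hμ : 0 < μ) {x : Vec d₁}
    (hx : x ∈ X) : r.gy x (r.yStar x) = 0 := by
  have hmin := Classical.epsilon_spec ((h.strongConvex x hx).exists_isMin hμ (h.hasGrad_g x hx))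
  have hloc : IsLocalMin (fun y => r.g x y) (r.yStar x) := Eventually.of_forall hmin
  simpa using hloc.hasFDerivAt_eq_zero (h.hasGrad_g x hx (r.yStar x)).hasFDerivAt

theorem norm_yStar_sub_le (h : r.Admissible X μ Lf0 Lf1 Lg1 Lg2 Q) (hμ : 0 < μ) {x x' : Vec d₁}
    (hx : x ∈ X) (hx' : x' ∈ X) : ‖r.yStar x - r.yStar x'‖ ≤ Lg1 / μ * ‖x - x'‖ := by
  have h1 := mul_norm_le_of_mul_norm_sq_le_inner
    (h.mul_norm_sq_le_inner_gy hx (r.yStar x) (r.yStar x'))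
  have h2 := h.lip_gy x hx x' hx' (r.yStar x') (r.yStar x')
  rw [h.gy_yStar hμ hx, zero_sub, norm_neg] at h1
  rw [h.gy_yStar hμ hx', sub_self, norm2_zero_right, sub_zero] at h2
  rw [div_mul_eq_mul_div, le_div_iff₀ hμ]
  linarith

theorem hasFDerivAt_gy (h : r.Admissible X μ Lf0 Lf1 Lg1 Lg2 Q) {x : Vec d₁}
    (hx : x ∈ X) (y : Vec d₂) : HasFDerivAt (r.gy x) (r.gyy x y) y := by
  have h1 := (h.hasDeriv_gy x hx y).comp y
    (hasFDerivAt_prodMk_right x y).hasFDerivWithinAt (s := univ) (fun z _ => ⟨hx, mem_univ z⟩)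
  rw [hasFDerivWithinAt_univ] at h1
  refine HasFDerivAt.congr_fderiv h1 ?_
  ext w
  simp

theorem norm_gyy_le (h : r.Admissible X μ Lf0 Lf1 Lg1 Lg2 Q) (hL : 0 ≤ Lg1) {x : Vec d₁}
    (hx : x ∈ X) (y : Vec d₂) : ‖r.gyy x y‖ ≤ Lg1 :=
  (h.hasFDerivAt_gy hx y).le_of_lip' hL (Eventually.of_forall fun z => h.norm_gy_sub_le hx z y)

theorem mul_norm_sq_le_inner_gyy (h : r.Admissible X μ Lf0 Lf1 Lg1 Lg2 Q) {x : Vec d₁}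
    (hx : x ∈ X) (y w : Vec d₂) : μ * ‖w‖ ^ 2 ≤ inner ℝ (r.gyy x y w) w := by
  have h1 : HasDerivAt (fun s : ℝ => inner ℝ (r.gy x (y + s • w)) w)
      (inner ℝ (r.gyy x y w) w) 0 := by
    have h2 : HasDerivAt (fun s : ℝ => r.gy x (y + s • w)) (r.gyy x y w) 0 :=
      (h.hasFDerivAt_gy hx y).hasLineDerivAt w
    simpa using h2.inner ℝ (hasDerivAt_const 0 w)
  have h2 := (hasDerivWithinAt_iff_tendsto_slope' (s := Ioi (0 : ℝ)) (by simp)).1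
    h1.hasDerivWithinAt
  refine ge_of_tendsto h2 ?_
  filter_upwards [self_mem_nhdsWithin] with s hs
  have hs0 : 0 < s := hs
  have h3 := h.mul_norm_sq_le_inner_gy hx (y + s • w) y
  rw [add_sub_cancel_left, inner_smul_right, norm_smul, Real.norm_of_nonneg hs0.le,
    inner_sub_left] at h3
  rw [slope_def_field, zero_smul, add_zero, sub_zero, le_div_iff₀ hs0]
  refine le_of_mul_le_mul_left ?_ hs0
  linarith

theorem inner_gyy_comm (h : r.Admissible X μ Lf0 Lf1 Lg1 Lg2 Q) {x : Vec d₁}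
    (hx : x ∈ X) (y v w : Vec d₂) : inner ℝ (r.gyy x y v) w = inner ℝ v (r.gyy x y w) := by
  have hB := isBoundedBilinearMap_inner (𝕜 := ℝ) (E := Vec d₂)
  have h1 : ∀ z, HasFDerivAt (r.g x) (hB.toContinuousLinearMap (r.gy x z)) z := fun z => by
    refine (h.hasGrad_g x hx z).hasFDerivAt.congr_fderiv ?_
    ext w
    rfl
  have h2 := hB.toContinuousLinearMap.hasFDerivAt.comp y (h.hasFDerivAt_gy hx y)
  have h3 := second_derivative_symmetric h1 h2 v w
  rw [real_inner_comm _ v]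
  exact h3

theorem norm_fy_le (h : r.Admissible X μ Lf0 Lf1 Lg1 Lg2 Q) (hL : 0 ≤ Lf0) {x : Vec d₁}
    (hx : x ∈ X) (y : Vec d₂) : ‖r.fy x y‖ ≤ Lf0 := by
  have h1 := (h.hasDeriv_f x hx y).comp y
    (hasFDerivAt_prodMk_right x y).hasFDerivWithinAt (s := univ) (fun z _ => ⟨hx, mem_univ z⟩)
  rw [hasFDerivWithinAt_univ] at h1
  have h2 : HasFDerivAt (r.f x) (innerSL ℝ (r.fy x y)) y := by
    refine HasFDerivAt.congr_fderiv h1 ?_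
    ext w
    simp
  rw [← innerSL_apply_norm (𝕜 := ℝ)]
  refine h2.le_of_lip' hL (Eventually.of_forall fun z => ?_)
  simpa [norm2_zero_left] using h.lip_f x hx x hx z y

/-- `∇²_{xy} g` is bounded by `Lg1` when paired with differences of feasible points; in directions
orthogonal to `X` nothing is known about it. -/
theorem abs_inner_gxy_le (h : r.Admissible X μ Lf0 Lf1 Lg1 Lg2 Q) (hc : Convex ℝ X)
    (hL : 0 ≤ Lg1) {x u u' : Vec d₁} (hx : x ∈ X) (hu : u ∈ X) (hu' : u' ∈ X) (y w : Vec d₂) :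
    |inner ℝ (r.gxy x y w) (u - u')| ≤ Lg1 * ‖w‖ * ‖u - u'‖ := by
  -- Both `±(u - u')` are feasible directions at the points `m s` for `0 < s < 1`, and `m s → x`.
  set m : ℝ → Vec d₁ := fun s => x + s • ((1 / 2 : ℝ) • (u + u') - x) with hm
  have hmem : ∀ s ∈ Ioo (0 : ℝ) 1, ∀ τ ∈ Icc (-(s / 2)) (s / 2), m s + τ • (u - u') ∈ X := by
    intro s hs τ hτ
    have hq : (1 / 2 + τ / s) • u + (1 / 2 - τ / s) • u' ∈ X := by
      have h1 : |τ / s| ≤ 1 / 2 := by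
        rw [abs_div, abs_of_pos hs.1, div_le_iff₀ hs.1]
        exact (abs_le.2 hτ).trans (by linarith)
      have := abs_le.1 h1
      exact hc hu hu' (by linarith) (by linarith) (by ring)
    have h2 := hc hx hq (sub_nonneg.2 hs.2.le) hs.1.le (by ring)
    convert h2 using 1
    have hs0 : s ≠ 0 := hs.1.ne'
    have h3 : τ = s * (τ / s) := by field_simp
    rw [hm]
    nth_rewrite 1 [h3]
    module
  have hbound : ∀ s ∈ Ioo (0 : ℝ) 1, |inner ℝ (r.gxy (m s) y w) (u - u')| ≤
      Lg1 * ‖w‖ * ‖u - u'‖ := by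
    intro s hs
    have hms : m s ∈ X := by simpa using hmem s hs 0 ⟨by linarith [hs.1], by linarith [hs.1]⟩
    have hline : HasDerivWithinAt (fun τ : ℝ => (m s + τ • (u - u'), y)) (u - u', (0 : Vec d₂))
        (Icc (-(s / 2)) (s / 2)) 0 := by
      have h1 : HasDerivAt (fun τ : ℝ => m s + τ • (u - u')) (u - u') 0 := by
        simpa using ((hasDerivAt_id (0 : ℝ)).smul_const (u - u')).const_add (m s)
      exact (h1.prodMk (hasDerivAt_const 0 y)).hasDerivWithinAt
    have h1 := h.hasDeriv_gy (m s) hms y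
    rw [show (m s, y) = (m s + (0 : ℝ) • (u - u'), y) by simp] at h1
    have hmaps : MapsTo (fun τ : ℝ => (m s + τ • (u - u'), y)) (Icc (-(s / 2)) (s / 2))
        (X ×ˢ (univ : Set (Vec d₂))) := fun τ hτ => ⟨hmem s hs τ hτ, mem_univ _⟩
    have h2 := (h1.comp_hasDerivWithinAt 0 hline hmaps).hasDerivAt
      (Icc_mem_nhds (by linarith [hs.1]) (by linarith [hs.1]))
    have h3 := h2.le_of_lip' (C := Lg1 * ‖u - u'‖) (by positivity) (by
      filter_upwards [Icc_mem_nhds (show -(s / 2) < (0 : ℝ) by linarith [hs.1])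
        (show (0 : ℝ) < s / 2 by linarith [hs.1])] with τ hτ
      have h4 := h.lip_gy _ (hmem s hs τ hτ) _ hms y y
      rw [sub_self, norm2_zero_right, add_sub_cancel_left, norm_smul] at h4
      simp only [Function.comp_apply, zero_smul, add_zero, sub_zero]
      linarith)
    simp only [add_apply, ContinuousLinearMap.comp_apply,
      ContinuousLinearMap.coe_fst', ContinuousLinearMap.coe_snd', map_zero, add_zero] at h3
    rw [← ContinuousLinearMap.adjoint_inner_right]
    calc _ ≤ ‖w‖ * _ := abs_real_inner_le_norm _ _
      _ ≤ ‖w‖ * (Lg1 * ‖u - u'‖) := by gcongr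
      _ = _ := by ring
  set K := Lg2 * ‖(1 / 2 : ℝ) • (u + u') - x‖ * ‖w‖ * ‖u - u'‖ with hK
  have hlim : Tendsto (fun s : ℝ => Lg1 * ‖w‖ * ‖u - u'‖ + s * K) (𝓝[>] 0)
      (𝓝 (Lg1 * ‖w‖ * ‖u - u'‖ + 0 * K)) := by
    have : Continuous (fun s : ℝ => Lg1 * ‖w‖ * ‖u - u'‖ + s * K) := by fun_prop
    exact (this.tendsto 0).mono_left nhdsWithin_le_nhds
  rw [zero_mul, add_zero] at hlim
  refine ge_of_tendsto hlim ?_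
  filter_upwards [Ioo_mem_nhdsGT (zero_lt_one' ℝ)] with s hs
  have hms : m s ∈ X := by simpa using hmem s hs 0 ⟨by linarith [hs.1], by linarith [hs.1]⟩
  have h1 := h.lip_gxy x hx (m s) hms y y
  have h2 : x - m s = -(s • ((1 / 2 : ℝ) • (u + u') - x)) := by simp [hm]
  rw [sub_self, norm2_zero_right, h2, norm_neg, norm_smul, Real.norm_of_nonneg hs.1.le] at h1
  have h3 : |inner ℝ ((r.gxy x y - r.gxy (m s) y) w) (u - u')| ≤ s * K := by
    calc _ ≤ ‖(r.gxy x y - r.gxy (m s) y) w‖ * ‖u - u'‖ := abs_real_inner_le_norm _ _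
      _ ≤ ‖r.gxy x y - r.gxy (m s) y‖ * ‖w‖ * ‖u - u'‖ := by
        gcongr; exact ContinuousLinearMap.le_opNorm _ _
      _ ≤ (Lg2 * (s * ‖(1 / 2 : ℝ) • (u + u') - x‖)) * ‖w‖ * ‖u - u'‖ := by gcongr
      _ = _ := by rw [hK]; ring
  rw [sub_apply, inner_sub_left] at h3
  have h4 := abs_sub_abs_le_abs_sub (inner ℝ (r.gxy x y w) (u - u'))
    (inner ℝ (r.gxy (m s) y w) (u - u'))
  linarith [hbound s hs]

theorem gyy_vStar (h : r.Admissible X μ Lf0 Lf1 Lg1 Lg2 Q) (hμ : 0 < μ) {x : Vec d₁}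
    (hx : x ∈ X) : r.gyy x (r.yStar x) (r.vStar x) = r.fy x (r.yStar x) :=
  Classical.epsilon_spec (surjective_of_mul_norm_sq_le_inner hμ
    (h.mul_norm_sq_le_inner_gyy hx (r.yStar x)) (r.fy x (r.yStar x)))

theorem norm_vStar_le (h : r.Admissible X μ Lf0 Lf1 Lg1 Lg2 Q) (hμ : 0 < μ) (hL : 0 ≤ Lf0)
    {x : Vec d₁} (hx : x ∈ X) : ‖r.vStar x‖ ≤ Lf0 / μ := by
  have h1 := mul_norm_le_of_mul_norm_sq_le_inner
    (h.mul_norm_sq_le_inner_gyy hx (r.yStar x) (r.vStar x))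
  rw [h.gyy_vStar hμ hx] at h1
  rw [le_div_iff₀ hμ]
  linarith [h.norm_fy_le hL hx (r.yStar x)]

/-- Perturbation bound for `v*`, between two rounds and two points. -/
theorem mul_norm_vStar_sub_le {r' : Round d₁ d₂} (h : r.Admissible X μ Lf0 Lf1 Lg1 Lg2 Q)
    (h' : r'.Admissible X μ Lf0 Lf1 Lg1 Lg2 Q) (hμ : 0 < μ) (hL : 0 ≤ Lf0)
    {x x' : Vec d₁} (hx : x ∈ X) (hx' : x' ∈ X) :
    μ * ‖r.vStar x - r'.vStar x'‖ ≤ ‖r.fy x (r.yStar x) - r'.fy x' (r'.yStar x')‖ +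
      ‖r.gyy x (r.yStar x) - r'.gyy x' (r'.yStar x')‖ * (Lf0 / μ) := by
  have h1 := mul_norm_le_of_mul_norm_sq_le_inner
    (h.mul_norm_sq_le_inner_gyy hx (r.yStar x) (r.vStar x - r'.vStar x'))
  have h2 : r.gyy x (r.yStar x) (r.vStar x - r'.vStar x') =
      (r.fy x (r.yStar x) - r'.fy x' (r'.yStar x')) -
        (r.gyy x (r.yStar x) - r'.gyy x' (r'.yStar x')) (r'.vStar x') := by
    rw [map_sub, h.gyy_vStar hμ hx, sub_apply, h'.gyy_vStar hμ hx']
    abel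
  rw [h2] at h1
  refine h1.trans ((norm_sub_le _ _).trans ?_)
  gcongr
  exact ContinuousLinearMap.le_opNorm_of_le _ (h'.norm_vStar_le hμ hL hx')

theorem norm_vStar_sub_le (h : r.Admissible X μ Lf0 Lf1 Lg1 Lg2 Q) (hμ : 0 < μ) (hL : 0 ≤ Lf0)
    (hLf1 : 0 ≤ Lf1) (hLg2 : 0 ≤ Lg2) {x x' : Vec d₁} (hx : x ∈ X) (hx' : x' ∈ X) :
    ‖r.vStar x - r.vStar x'‖ ≤
      (Lf1 + Lg2 * (Lf0 / μ)) * (1 + Lg1 / μ) / μ * ‖x - x'‖ := by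
  have h1 := h.mul_norm_vStar_sub_le h hμ hL hx hx'
  have hN : norm2 (x - x') (r.yStar x - r.yStar x') ≤ (1 + Lg1 / μ) * ‖x - x'‖ :=
    (norm2_le_add _ _).trans (by linarith [h.norm_yStar_sub_le hμ hx hx'])
  have h2 := (norm_le_norm2_right _ _).trans
    (h.lip_grad_f x hx x' hx' (r.yStar x) (r.yStar x'))
  have h3 := h.lip_gyy x hx x' hx' (r.yStar x) (r.yStar x')
  have h4 : 0 ≤ Lf0 / μ := by positivity
  rw [div_mul_eq_mul_div, le_div_iff₀ hμ, mul_comm]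
  calc _ ≤ _ := h1
    _ ≤ Lf1 * ((1 + Lg1 / μ) * ‖x - x'‖) + Lg2 * ((1 + Lg1 / μ) * ‖x - x'‖) * (Lf0 / μ) := by
      gcongr
      · exact h2.trans (by gcongr)
      · exact h3.trans (by gcongr)
    _ = _ := by ring

/-- Lipschitz continuity of the hypergradient estimate within one round; it yields both the
smoothness of `F` and the bound on the bias. -/
theorem abs_inner_dirX_sub_le (h : r.Admissible X μ Lf0 Lf1 Lg1 Lg2 Q) (hc : Convex ℝ X)
    (hL : 0 ≤ Lg1) {x x' u u' : Vec d₁} (hx : x ∈ X) (hx' : x' ∈ X) (hu : u ∈ X)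
    (hu' : u' ∈ X) (y y' v v' : Vec d₂) {ρ N W : ℝ} (hLf1 : 0 ≤ Lf1) (hLg2 : 0 ≤ Lg2)
    (hρ : ‖v'‖ ≤ ρ) (hN : norm2 (x - x') (y - y') ≤ N) (hW : ‖v - v'‖ ≤ W) :
    |inner ℝ (r.dirX x y v - r.dirX x' y' v') (u - u')| ≤
      ((Lf1 + Lg2 * ρ) * N + Lg1 * W) * ‖u - u'‖ := by
  have h1 : r.dirX x y v - r.dirX x' y' v' =
      (r.fx x y - r.fx x' y' - (r.gxy x y - r.gxy x' y') v') - r.gxy x y (v - v') := by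
    simp only [dirX, map_sub, sub_apply]
    abel
  have hN0 : 0 ≤ N := (Real.sqrt_nonneg _).trans hN
  rw [h1, inner_sub_left]
  refine (abs_sub _ _).trans ?_
  have h2 := h.abs_inner_gxy_le hc hL hx hu hu' y (v - v')
  have h3 : ‖r.fx x y - r.fx x' y' - (r.gxy x y - r.gxy x' y') v'‖ ≤ (Lf1 + Lg2 * ρ) * N := by
    calc _ ≤ ‖r.fx x y - r.fx x' y'‖ + ‖(r.gxy x y - r.gxy x' y') v'‖ := norm_sub_le _ _
      _ ≤ Lf1 * N + Lg2 * N * ρ := by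
        gcongr
        · exact (norm_le_norm2_left _ _).trans ((h.lip_grad_f x hx x' hx' y y').trans (by gcongr))
        · refine (ContinuousLinearMap.le_opNorm_of_le _ hρ).trans ?_
          have := (norm_nonneg _).trans hρ
          gcongr
          exact (h.lip_gxy x hx x' hx' y y').trans (by gcongr)
      _ = _ := by ring
  have h4 := (abs_real_inner_le_norm _ _).trans
    (mul_le_mul_of_nonneg_right h3 (norm_nonneg (u - u')))
  have h5 : Lg1 * ‖v - v'‖ * ‖u - u'‖ ≤ Lg1 * W * ‖u - u'‖ := by gcongr
  linarith

/-- The derivative of `F` within `X`. Since `∇_y g` vanishes along `y*`, on `X` the function `F`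
is also the restriction of the Lagrangian `f - ⟨v*(x), ∇_y g⟩` with multiplier frozen at `x`; its
`y`-derivative at `(x, y*(x))` vanishes, so Lipschitz continuity of `y*` is enough. -/
theorem hasGradientWithinAt_F (h : r.Admissible X μ Lf0 Lf1 Lg1 Lg2 Q) (hμ : 0 < μ)
    {x : Vec d₁} (hx : x ∈ X) : HasGradientWithinAt r.F (r.hyperGrad x) X x := by
  set v := r.vStar x with hv
  set y := r.yStar x with hy
  have hΨ : HasFDerivWithinAt
      (fun z : Vec d₁ × Vec d₂ => r.f z.1 z.2 - inner ℝ v (r.gy z.1 z.2))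
      ((innerSL ℝ (r.hyperGrad x)).comp (ContinuousLinearMap.fst ℝ (Vec d₁) (Vec d₂)))
      (X ×ˢ univ) (x, y) := by
    refine ((h.hasDeriv_f x hx y).sub ((innerSL ℝ v).hasFDerivAt.comp_hasFDerivWithinAt (x, y)
      (h.hasDeriv_gy x hx y))).congr_fderiv ?_
    ext w
    · simp [hyperGrad, dirX, ← hv, ← hy, ContinuousLinearMap.adjoint_inner_right]
    · simp [← h.inner_gyy_comm hx, hv, hy, h.gyy_vStar hμ hx]
  rw [hasGradientWithinAt_iff_hasFDerivWithinAt]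
  refine HasFDerivWithinAt.of_isLittleO ?_
  have hO : (fun x' => ((x', r.yStar x') : Vec d₁ × Vec d₂) - (x, y)) =O[𝓝[X] x]
      fun x' => x' - x := by
    refine Asymptotics.IsBigO.of_bound (max 1 (Lg1 / μ)) ?_
    filter_upwards [self_mem_nhdsWithin] with x' hx'
    rw [Prod.mk_sub_mk, Prod.norm_mk]
    refine max_le ?_ ?_
    · exact le_mul_of_one_le_left (norm_nonneg _) (le_max_left _ _)
    · exact (h.norm_yStar_sub_le hμ hx' hx).trans (by gcongr; exact le_max_right _ _)
  have hT : Tendsto (fun x' => ((x', r.yStar x') : Vec d₁ × Vec d₂)) (𝓝[X] x)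
      (𝓝[X ×ˢ univ] (x, y)) := by
    refine tendsto_nhdsWithin_iff.2 ⟨?_, ?_⟩
    · have h0 : Tendsto (fun x' => x' - x) (𝓝[X] x) (𝓝 0) := by
        have : Continuous fun x' : Vec d₁ => x' - x := by fun_prop
        simpa using (this.tendsto x).mono_left nhdsWithin_le_nhds
      exact tendsto_sub_nhds_zero_iff.1 (hO.trans_tendsto h0)
    · filter_upwards [self_mem_nhdsWithin] with x' hx' using ⟨hx', mem_univ _⟩
  refine ((hΨ.isLittleO.comp_tendsto hT).trans_isBigO hO).congr' ?_ EventuallyEq.rfl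
  filter_upwards [self_mem_nhdsWithin] with x' hx'
  simp [h.gy_yStar hμ hx', h.gy_yStar hμ hx, F, hy]

theorem inner_gradientWithin_F (h : r.Admissible X μ Lf0 Lf1 Lg1 Lg2 Q) (hμ : 0 < μ)
    (hc : Convex ℝ X) {x u u' : Vec d₁} (hx : x ∈ X) (hu : u ∈ X) (hu' : u' ∈ X) :
    inner ℝ (gradientWithin r.F X x) (u - u') = inner ℝ (r.hyperGrad x) (u - u') := by
  have h1 := h.hasGradientWithinAt_F hμ hx
  have h2 := h1.differentiableWithinAt.hasGradientWithinAt
  have h3 : ∀ w ∈ X, inner ℝ (gradientWithin r.F X x) (w - x) =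
      inner ℝ (r.hyperGrad x) (w - x) := fun w hw => by
    have := h2.hasFDerivWithinAt.unique_on h1.hasFDerivWithinAt
      (mem_tangentConeAt_of_segment_subset (hc.segment_subset hx hw))
    simpa using this
  rw [← sub_sub_sub_cancel_right u u' x, inner_sub_right, inner_sub_right _ (u - x), h3 u hu,
    h3 u' hu']

/-- The smoothness constant of the bilevel objective. -/
noncomputable def lipF (μ Lf0 Lf1 Lg1 Lg2 : ℝ) : ℝ :=
  (Lf1 + Lg2 * (Lf0 / μ)) * (1 + Lg1 / μ) +
    Lg1 * ((Lf1 + Lg2 * (Lf0 / μ)) * (1 + Lg1 / μ) / μ)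

/-- The descent lemma for `F` on `X`. -/
theorem F_le (h : r.Admissible X μ Lf0 Lf1 Lg1 Lg2 Q) (hμ : 0 < μ) (hL : 0 ≤ Lf0)
    (hLf1 : 0 ≤ Lf1) (hLg1 : 0 ≤ Lg1) (hLg2 : 0 ≤ Lg2) (hc : Convex ℝ X)
    {x x' : Vec d₁} (hx : x ∈ X) (hx' : x' ∈ X) :
    r.F x' ≤ r.F x + inner ℝ (r.hyperGrad x) (x' - x) +
      lipF μ Lf0 Lf1 Lg1 Lg2 / 2 * ‖x' - x‖ ^ 2 := by
  set LF := lipF μ Lf0 Lf1 Lg1 Lg2 with hLF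
  set l : ℝ → Vec d₁ := fun τ => x + τ • (x' - x) with hl
  have hmem : ∀ τ ∈ Icc (0 : ℝ) 1, l τ ∈ X := fun τ hτ => hc.add_smul_sub_mem hx hx' hτ
  have hderiv : ∀ τ ∈ Icc (0 : ℝ) 1, HasDerivWithinAt (fun τ => r.F (l τ))
      (inner ℝ (r.hyperGrad (l τ)) (x' - x)) (Icc 0 1) τ := fun τ hτ => by
    have h1 : HasDerivWithinAt l (x' - x) (Icc 0 1) τ := by
      have := (((hasDerivAt_id τ).smul_const (x' - x)).const_add x).hasDerivWithinAt (s := Icc 0 1)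
      rw [one_smul] at this
      exact this
    exact (h.hasGradientWithinAt_F hμ (hmem τ hτ)).hasFDerivWithinAt.comp_hasDerivWithinAt τ
      h1 (fun s hs => hmem s hs)
  have hB : ∀ τ, HasDerivAt
      (fun τ : ℝ => r.F x + τ * inner ℝ (r.hyperGrad x) (x' - x) + LF / 2 * ‖x' - x‖ ^ 2 * τ ^ 2)
      (inner ℝ (r.hyperGrad x) (x' - x) + LF * τ * ‖x' - x‖ ^ 2) τ := fun τ => by
    have h1 := (((hasDerivAt_id τ).mul_const (inner ℝ (r.hyperGrad x) (x' - x))).const_add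
      (r.F x)).add (((hasDerivAt_id τ).pow 2).const_mul (LF / 2 * ‖x' - x‖ ^ 2))
    refine (h1.congr_deriv ?_)
    simp
    ring
  have h1 := image_le_of_deriv_right_le_deriv_boundary (a := 0) (b := 1)
    (fun τ hτ => (hderiv τ hτ).continuousWithinAt)
    (fun τ hτ => (hderiv τ (Ico_subset_Icc_self hτ)).mono_of_mem_nhdsWithin
      (Icc_mem_nhdsGE_of_mem hτ))
    (B := fun τ : ℝ => r.F x + τ * inner ℝ (r.hyperGrad x) (x' - x) +
      LF / 2 * ‖x' - x‖ ^ 2 * τ ^ 2) (by simp [hl])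
    (fun τ _ => (hB τ).continuousAt.continuousWithinAt)
    (fun τ _ => (hB τ).hasDerivWithinAt)
    (fun τ hτ => by
      have hτ' := Ico_subset_Icc_self hτ
      have hlx : ‖l τ - x‖ = τ * ‖x' - x‖ := by
        simp [hl, norm_smul, abs_of_nonneg hτ.1]
      have h2 := h.abs_inner_dirX_sub_le hc hLg1 (hmem τ hτ') hx hx' hx
        (r.yStar (l τ)) (r.yStar x) (r.vStar (l τ)) (r.vStar x) hLf1 hLg2
        (h.norm_vStar_le hμ hL hx)
        ((norm2_le_add _ _).trans (add_le_add le_rfl (h.norm_yStar_sub_le hμ (hmem τ hτ') hx)))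
        (h.norm_vStar_sub_le hμ hL hLf1 hLg2 (hmem τ hτ') hx)
      have h3 := (le_abs_self _).trans h2
      rw [inner_sub_left, hlx] at h3
      have h4 : ((Lf1 + Lg2 * (Lf0 / μ)) * (τ * ‖x' - x‖ + Lg1 / μ * (τ * ‖x' - x‖)) +
          Lg1 * ((Lf1 + Lg2 * (Lf0 / μ)) * (1 + Lg1 / μ) / μ * (τ * ‖x' - x‖))) * ‖x' - x‖ =
          LF * τ * ‖x' - x‖ ^ 2 := by
        rw [hLF, lipF]; ring
      rw [h4] at h3
      unfold hyperGrad
      linarith)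
    (x := 1) (by simp)
  simp only [hl, one_smul, add_sub_cancel, one_mul, one_pow, mul_one] at h1
  exact h1

end Admissible

end Round

end SOGD

/-! ### Recursive inequalities -/

namespace SOGD

open Finset

/-- A sequence that contracts up to an input `p` is square-summable against the input. -/
theorem sum_sq_le_of_contraction {ρ : ℝ} (hρ : 0 < ρ) (hρ1 : ρ ≤ 1) {z p : ℕ → ℝ}
    (hz : ∀ t, 0 ≤ z t) {T : ℕ} (hT : 1 ≤ T)
    (h : ∀ t ∈ Icc 2 T, z t ≤ (1 - ρ) * z (t - 1) + p t) :
    ∑ t ∈ Icc 1 T, z t ^ 2 ≤ z 1 ^ 2 / ρ + (∑ t ∈ Icc 2 T, p t ^ 2) / ρ ^ 2 := by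
  have key : ∀ T, 1 ≤ T → (∀ t ∈ Icc 2 T, z t ≤ (1 - ρ) * z (t - 1) + p t) →
      ρ * ∑ t ∈ Icc 1 T, z t ^ 2 + (1 - ρ) * z T ^ 2 ≤
        z 1 ^ 2 + (∑ t ∈ Icc 2 T, p t ^ 2) / ρ := by
    intro T hT
    induction T, hT using Nat.le_induction with
    | base => intro _; simp; linarith
    | succ n hn ih =>
      intro h
      have h1 := ih fun t ht => h t (Icc_subset_Icc_right n.le_succ ht)
      have h2 := h (n + 1) (mem_Icc.2 ⟨by omega, le_rfl⟩)
      rw [Nat.add_sub_cancel] at h2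
      rw [sum_Icc_succ_top (by omega), sum_Icc_succ_top (by omega), add_div]
      -- convexity of the square, for the weights `1 - ρ` and `ρ`
      have h3 : z (n + 1) ^ 2 ≤ (1 - ρ) * z n ^ 2 + p (n + 1) ^ 2 / ρ := by
        calc z (n + 1) ^ 2 ≤ ((1 - ρ) * z n + p (n + 1)) ^ 2 := by
              gcongr; exact hz _
          _ = (1 - ρ) * z n ^ 2 + p (n + 1) ^ 2 / ρ -
              (1 - ρ) * (ρ * z n - p (n + 1)) ^ 2 / ρ := by field_simp; ring
          _ ≤ _ := by
              have : 0 ≤ (1 - ρ) * (ρ * z n - p (n + 1)) ^ 2 / ρ :=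
                div_nonneg (mul_nonneg (by linarith) (sq_nonneg _)) hρ.le
              linarith
      linarith
  have h1 := key T hT h
  have h2 : ρ * ∑ t ∈ Icc 1 T, z t ^ 2 ≤ z 1 ^ 2 + (∑ t ∈ Icc 2 T, p t ^ 2) / ρ := by
    have := mul_nonneg (sub_nonneg.2 hρ1) (sq_nonneg (z T))
    linarith
  have h3 : z 1 ^ 2 / ρ + (∑ t ∈ Icc 2 T, p t ^ 2) / ρ ^ 2 =
      (z 1 ^ 2 + (∑ t ∈ Icc 2 T, p t ^ 2) / ρ) / ρ := by field_simp
  rw [h3, le_div_iff₀ hρ]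
  linarith

theorem sum_Icc_two_pred_le {u : ℕ → ℝ} (hu : ∀ t, 0 ≤ u t) (T : ℕ) :
    ∑ t ∈ Icc 2 T, u (t - 1) ≤ ∑ t ∈ Icc 1 T, u t := by
  have h1 : ∑ t ∈ Icc 2 T, u (t - 1) = ∑ t ∈ (Icc 2 T).image (· - 1), u t := by
    rw [sum_image]
    intro a ha b hb hab
    have ha' := (mem_Icc.1 (mem_coe.1 ha)).1
    have hb' := (mem_Icc.1 (mem_coe.1 hb)).1
    have hab' : a - 1 = b - 1 := hab
    omega
  rw [h1]
  refine sum_le_sum_of_subset_of_nonneg ?_ fun t _ _ => hu t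
  intro t ht
  obtain ⟨a, ha, rfl⟩ := mem_image.1 ht
  have := mem_Icc.1 ha
  exact mem_Icc.2 ⟨by omega, by omega⟩

theorem sum_sub_telescope_le {φ φ' V : ℕ → ℝ} {T : ℕ} (hT : 1 ≤ T)
    (h : ∀ t ∈ Icc 2 T, φ t - φ' (t - 1) ≤ V t) :
    ∑ t ∈ Icc 1 T, (φ t - φ' t) ≤ φ 1 - φ' T + ∑ t ∈ Icc 2 T, V t := by
  induction T, hT using Nat.le_induction with
  | base => simp
  | succ n hn ih =>
    have h1 := ih fun t ht => h t (Icc_subset_Icc_right n.le_succ ht)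
    have h2 := h (n + 1) (mem_Icc.2 ⟨by omega, le_rfl⟩)
    rw [Nat.add_sub_cancel] at h2
    rw [sum_Icc_succ_top (by omega), sum_Icc_succ_top (by omega)]
    linarith

theorem add_add_sq_le (x y z : ℝ) : (x + y + z) ^ 2 ≤ 3 * x ^ 2 + 3 * y ^ 2 + 3 * z ^ 2 := by
  nlinarith [sq_nonneg (x - y), sq_nonneg (x - z), sq_nonneg (y - z)]

theorem sum_add_sq_le (s : Finset ℕ) (A B : ℝ) (u v : ℕ → ℝ) :
    ∑ t ∈ s, (A * u t + B * v t) ^ 2 ≤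
      2 * A ^ 2 * ∑ t ∈ s, u t ^ 2 + 2 * B ^ 2 * ∑ t ∈ s, v t ^ 2 := by
  rw [mul_sum, mul_sum, ← sum_add_distrib]
  refine sum_le_sum fun t _ => add_sq_le.trans_eq ?_
  ring

theorem sum_add_add_sq_le (s : Finset ℕ) (A B : ℝ) (u v k : ℕ → ℝ) :
    ∑ t ∈ s, (A * u t + B * v t + k t) ^ 2 ≤
      3 * A ^ 2 * ∑ t ∈ s, u t ^ 2 + 3 * B ^ 2 * ∑ t ∈ s, v t ^ 2 + 3 * ∑ t ∈ s, k t ^ 2 := by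
  rw [mul_sum, mul_sum, mul_sum, ← sum_add_distrib, ← sum_add_distrib]
  refine sum_le_sum fun t _ => (add_add_sq_le _ _ _).trans_eq ?_
  ring

/-- The accumulated squared bias `A a + B w`, for tracking errors `a`, `w` that contract with rate
`σ m` and are driven by the outer steps `D` and by the variations `h`, `k`. -/
theorem sum_sq_bias_le {m σ l M lv A B : ℝ} (hm : 0 < m) (hσ : 0 < σ) (hσm : σ * m ≤ 1) {T : ℕ}
    (hT : 1 ≤ T) {a w D h k : ℕ → ℝ} (ha : ∀ t, 0 ≤ a t) (hw : ∀ t, 0 ≤ w t)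
    (hrec_a : ∀ t ∈ Icc 2 T, a t ≤ (1 - σ * m) * a (t - 1) + (l * D (t - 1) + h t))
    (hrec_w : ∀ t ∈ Icc 2 T, w t ≤ (1 - σ * m) * w (t - 1) +
      (σ * M * a (t - 1) + lv * D (t - 1) + k t)) :
    ∑ t ∈ Icc 1 T, (A * a t + B * w t) ^ 2 ≤
      ((2 * A ^ 2 + 6 * B ^ 2 * M ^ 2 / m ^ 2) * (2 * l ^ 2) + 6 * B ^ 2 * lv ^ 2) / m ^ 2 *
        ((∑ t ∈ Icc 1 T, D t ^ 2) / σ ^ 2) +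
      ((2 * A ^ 2 + 6 * B ^ 2 * M ^ 2 / m ^ 2) *
          (a 1 ^ 2 / (σ * m) + 2 / (σ * m) ^ 2 * ∑ t ∈ Icc 2 T, h t ^ 2) +
        2 * B ^ 2 * (w 1 ^ 2 / (σ * m) + 3 / (σ * m) ^ 2 * ∑ t ∈ Icc 2 T, k t ^ 2)) := by
  have hρ : 0 < σ * m := mul_pos hσ hm
  have hDp := sum_Icc_two_pred_le (u := fun t => D t ^ 2) (fun t => sq_nonneg _) T
  have hap := sum_Icc_two_pred_le (u := fun t => a t ^ 2) (fun t => sq_nonneg _) T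
  have hSa := sum_sq_le_of_contraction hρ hσm ha hT hrec_a
  have hSw := sum_sq_le_of_contraction hρ hσm hw hT hrec_w
  have hpa := sum_add_sq_le (Icc 2 T) l 1 (fun t => D (t - 1)) h
  have hpw := sum_add_add_sq_le (Icc 2 T) (σ * M) lv (fun t => a (t - 1)) (fun t => D (t - 1)) k
  have hSb := sum_add_sq_le (Icc 1 T) A B a w
  simp only [one_mul, one_pow, mul_one] at hpa
  generalize ∑ t ∈ Icc 1 T, (A * a t + B * w t) ^ 2 = Sb at *
  generalize ∑ t ∈ Icc 2 T, (l * D (t - 1) + h t) ^ 2 = Spa at *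
  generalize ∑ t ∈ Icc 2 T, (σ * M * a (t - 1) + lv * D (t - 1) + k t) ^ 2 = Spw at *
  generalize ∑ t ∈ Icc 2 T, D (t - 1) ^ 2 = SDp at *
  generalize ∑ t ∈ Icc 2 T, a (t - 1) ^ 2 = Sap at *
  generalize ∑ t ∈ Icc 1 T, D t ^ 2 = SD at *
  generalize ∑ t ∈ Icc 1 T, a t ^ 2 = Sa at *
  generalize ∑ t ∈ Icc 1 T, w t ^ 2 = Sw at *
  generalize ∑ t ∈ Icc 2 T, h t ^ 2 = Sh at *
  generalize ∑ t ∈ Icc 2 T, k t ^ 2 = Sk at *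
  have h1 : Sa ≤ a 1 ^ 2 / (σ * m) + (2 * l ^ 2 * SD + 2 * Sh) / (σ * m) ^ 2 := by
    refine hSa.trans ?_
    gcongr
    exact hpa.trans (by gcongr)
  have h2 : Sw ≤ w 1 ^ 2 / (σ * m) +
      (3 * (σ * M) ^ 2 * Sa + 3 * lv ^ 2 * SD + 3 * Sk) / (σ * m) ^ 2 := by
    refine hSw.trans ?_
    gcongr
    exact hpw.trans (by gcongr)
  calc Sb ≤ 2 * A ^ 2 * Sa + 2 * B ^ 2 * Sw := hSb
    _ ≤ 2 * A ^ 2 * Sa + 2 * B ^ 2 * (w 1 ^ 2 / (σ * m) +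
        (3 * (σ * M) ^ 2 * Sa + 3 * lv ^ 2 * SD + 3 * Sk) / (σ * m) ^ 2) := by gcongr
    _ = (2 * A ^ 2 + 6 * B ^ 2 * M ^ 2 / m ^ 2) * Sa + 2 * B ^ 2 * (w 1 ^ 2 / (σ * m) +
        (3 * lv ^ 2 * SD + 3 * Sk) / (σ * m) ^ 2) := by field_simp; ring
    _ ≤ (2 * A ^ 2 + 6 * B ^ 2 * M ^ 2 / m ^ 2) *
          (a 1 ^ 2 / (σ * m) + (2 * l ^ 2 * SD + 2 * Sh) / (σ * m) ^ 2) +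
        2 * B ^ 2 * (w 1 ^ 2 / (σ * m) + (3 * lv ^ 2 * SD + 3 * Sk) / (σ * m) ^ 2) := by gcongr
    _ = _ := by field_simp; ring

/-- If the accumulated bias `Sb` contains the outer steps `SD` with a small factor only, the decrease
of the objective absorbs it. -/
theorem two_mul_add_le_of_absorb {K κ α SD Sb E rest : ℝ} (hα : 0 < α) (hκ : 0 < κ)
    (hK : 4 * K ≤ κ ^ 2) (hSD : 0 ≤ SD) (hSb : Sb ≤ K * (SD / (κ * α) ^ 2) + rest)
    (hE : SD / (2 * α) - α * Sb ≤ E) :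
    2 * (SD / α ^ 2) + 2 * Sb ≤ 10 * E / α + 12 * rest := by
  have h1 : SD = α ^ 2 * (SD / α ^ 2) := by field_simp
  set u := SD / α ^ 2 with hu
  have hu0 : 0 ≤ u := by positivity
  have h2 : K * (SD / (κ * α) ^ 2) ≤ u / 4 := by
    rw [h1, mul_pow, mul_comm (κ ^ 2), mul_div_mul_left _ _ (by positivity), mul_div_assoc',
      div_le_div_iff₀ (by positivity) (by norm_num)]
    nlinarith
  have h3 : u / 2 - Sb ≤ E / α := by
    rw [le_div_iff₀ hα]
    refine le_trans (le_of_eq ?_) hE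
    rw [hu]
    field_simp
  rw [mul_div_assoc]
  linarith

/-- The three coupled recursions in terms of real sequences: `a` and `w` are the tracking errors of
the inner and the linear-system variable, `D` the length of the outer steps, `G` the norm of the
gradient mapping, `φ t` and `φ' t` the values of the objective of round `t` before and after the
outer step; `h`, `k`, `V` are the variations. The tracking errors contain the outer steps with a
factor that decreases with the ratio `κ` of the step sizes, so that for large `κ` they are absorbed
by the decrease of the objective. -/
theorem exists_ratio_sum_sq_le {m l M lv A B : ℝ} (hm : 0 < m) :
    ∃ κ > (0 : ℝ), ∀ α > (0 : ℝ), κ * α * m ≤ 1 → ∀ Q ≥ (0 : ℝ), ∀ R ≥ (0 : ℝ),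
      ∃ C > (0 : ℝ), ∀ (T : ℕ) (a w D G h k V φ φ' : ℕ → ℝ),
        (∀ t, 0 ≤ a t) → (∀ t, 0 ≤ w t) → (∀ t, 0 ≤ V t) → (∀ t, 0 ≤ G t) →
        a 1 ≤ R → w 1 ≤ R →
        (∀ t ∈ Icc 1 T, |φ t| ≤ Q) → (∀ t ∈ Icc 1 T, |φ' t| ≤ Q) →
        (∀ t ∈ Icc 2 T, φ t - φ' (t - 1) ≤ V t) →
        (∀ t ∈ Icc 2 T, a t ≤ (1 - κ * α * m) * a (t - 1) + (l * D (t - 1) + h t)) →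
        (∀ t ∈ Icc 2 T, w t ≤ (1 - κ * α * m) * w (t - 1) +
          (κ * α * M * a (t - 1) + lv * D (t - 1) + k t)) →
        (∀ t ∈ Icc 1 T, φ' t ≤ φ t - D t ^ 2 / (2 * α) + α * (A * a t + B * w t) ^ 2) →
        (∀ t ∈ Icc 1 T, G t ≤ D t / α + (A * a t + B * w t)) →
        ∑ t ∈ Icc 1 T, G t ^ 2 ≤
          C * (1 + ∑ t ∈ Icc 2 T, V t + ∑ t ∈ Icc 2 T, h t ^ 2 + ∑ t ∈ Icc 2 T, k t ^ 2) := by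
  obtain ⟨N, hN⟩ : ∃ N, N = 2 * A ^ 2 + 6 * B ^ 2 * M ^ 2 / m ^ 2 := ⟨_, rfl⟩
  obtain ⟨K, hK⟩ : ∃ K, K = (N * (2 * l ^ 2) + 6 * B ^ 2 * lv ^ 2) / m ^ 2 := ⟨_, rfl⟩
  have hN0 : 0 ≤ N := by rw [hN]; positivity
  have hK0 : 0 ≤ K := by rw [hK]; positivity
  refine ⟨1 + 4 * K, by positivity, fun α hα hσ1 Q hQ R hR => ?_⟩
  have hκK : 4 * K ≤ (1 + 4 * K) ^ 2 := by nlinarith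
  have hκ0 : 0 < 1 + 4 * K := by positivity
  generalize 1 + 4 * K = κ at *
  have hρ0 : 0 < κ * α * m := by positivity
  obtain ⟨cH, hcH⟩ : ∃ c, c = 12 * (N * (2 / (κ * α * m) ^ 2)) := ⟨_, rfl⟩
  obtain ⟨cK, hcK⟩ : ∃ c, c = 12 * (2 * B ^ 2 * (3 / (κ * α * m) ^ 2)) := ⟨_, rfl⟩
  obtain ⟨c0, hc0⟩ : ∃ c, c = 20 * Q / α + 12 * (N * (R ^ 2 / (κ * α * m)) +
    2 * B ^ 2 * (R ^ 2 / (κ * α * m))) := ⟨_, rfl⟩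
  have hcH0 : 0 ≤ cH := by rw [hcH]; positivity
  have hcK0 : 0 ≤ cK := by rw [hcK]; positivity
  have hc00 : 0 ≤ c0 := by rw [hc0]; positivity
  have hα' : 0 < 10 / α := by positivity
  refine ⟨c0 + 10 / α + cH + cK, by positivity, ?_⟩
  intro T a w D G h k V φ φ' ha hw hV hG ha1 hw1 hφ hφ' hφV hrec_a hrec_w hdesc hGle
  have hSV : 0 ≤ ∑ t ∈ Icc 2 T, V t := sum_nonneg fun t _ => hV t
  have hSh : 0 ≤ ∑ t ∈ Icc 2 T, h t ^ 2 := sum_nonneg fun t _ => sq_nonneg _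
  have hSk : 0 ≤ ∑ t ∈ Icc 2 T, k t ^ 2 := sum_nonneg fun t _ => sq_nonneg _
  have hSD : 0 ≤ ∑ t ∈ Icc 1 T, D t ^ 2 := sum_nonneg fun t _ => sq_nonneg _
  rcases Nat.eq_zero_or_pos T with rfl | hT
  · simp; positivity
  have hSb := sum_sq_bias_le (A := A) (B := B) hm (mul_pos hκ0 hα) hσ1 hT ha hw hrec_a hrec_w
  rw [← hN, ← hK] at hSb
  have hrest : N * (a 1 ^ 2 / (κ * α * m) + 2 / (κ * α * m) ^ 2 * ∑ t ∈ Icc 2 T, h t ^ 2) +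
      2 * B ^ 2 * (w 1 ^ 2 / (κ * α * m) + 3 / (κ * α * m) ^ 2 * ∑ t ∈ Icc 2 T, k t ^ 2) ≤
      N * (R ^ 2 / (κ * α * m) + 2 / (κ * α * m) ^ 2 * ∑ t ∈ Icc 2 T, h t ^ 2) +
      2 * B ^ 2 * (R ^ 2 / (κ * α * m) + 3 / (κ * α * m) ^ 2 * ∑ t ∈ Icc 2 T, k t ^ 2) := by
    gcongr
    · exact ha 1
    · exact hw 1
  have hdec : (∑ t ∈ Icc 1 T, D t ^ 2) / (2 * α) - α * ∑ t ∈ Icc 1 T, (A * a t + B * w t) ^ 2 ≤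
      2 * Q + ∑ t ∈ Icc 2 T, V t := by
    have htel := sum_sub_telescope_le hT hφV
    have hb1 := (abs_le.1 (hφ 1 (mem_Icc.2 ⟨le_rfl, hT⟩))).2
    have hbT := (abs_le.1 (hφ' T (mem_Icc.2 ⟨hT, le_rfl⟩))).1
    refine le_trans ?_ (show ∑ t ∈ Icc 1 T, (φ t - φ' t) ≤ _ by linarith)
    rw [sum_div, mul_sum, ← sum_sub_distrib]
    exact sum_le_sum fun t ht => by linarith [hdesc t ht]
  have hSG : ∑ t ∈ Icc 1 T, G t ^ 2 ≤ 2 * ((∑ t ∈ Icc 1 T, D t ^ 2) / α ^ 2) +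
      2 * ∑ t ∈ Icc 1 T, (A * a t + B * w t) ^ 2 := by
    rw [sum_div, mul_sum, mul_sum, ← sum_add_distrib]
    refine sum_le_sum fun t ht => ?_
    rw [← div_pow, ← mul_add]
    refine le_trans ?_ add_sq_le
    gcongr
    · exact hG t
    · exact hGle t ht
  have habs := two_mul_add_le_of_absorb hα hκ0 hκK hSD (hSb.trans (add_le_add_right hrest _)) hdec
  generalize ∑ t ∈ Icc 2 T, V t = SV at *
  generalize ∑ t ∈ Icc 2 T, h t ^ 2 = Sh at *
  generalize ∑ t ∈ Icc 2 T, k t ^ 2 = Sk at *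
  calc _ ≤ _ := hSG.trans habs
    _ = c0 + 10 / α * SV + cH * Sh + cK * Sk := by rw [hc0, hcH, hcK]; ring
    _ ≤ (c0 + 10 / α + cH + cK) * (1 + SV + Sh + Sk) := by
      have e1 := mul_nonneg hc00 hSV
      have e2 := mul_nonneg hc00 hSh
      have e3 := mul_nonneg hc00 hSk
      have e4 := mul_nonneg hα'.le hSh
      have e5 := mul_nonneg hα'.le hSk
      have e6 := mul_nonneg hcH0 hSV
      have e7 := mul_nonneg hcH0 hSk
      have e8 := mul_nonneg hcK0 hSV
      have e9 := mul_nonneg hcK0 hSh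
      linarith

end SOGD

/-! ### One step of the algorithm -/

namespace SOGD

variable {d₁ d₂ : ℕ}

namespace Round.Admissible

variable {r : Round d₁ d₂} {X : Set (Vec d₁)} {μ Lf0 Lf1 Lg1 Lg2 Q : ℝ}

theorem norm_step_y_sub_le (h : r.Admissible X μ Lf0 Lf1 Lg1 Lg2 Q) (hμ : 0 < μ) {x : Vec d₁}
    (hx : x ∈ X) (y : Vec d₂) {s : ℝ} (hs : 0 ≤ s) (hsL : s * Lg1 ^ 2 ≤ μ) (hsμ : s * μ ≤ 1) :
    ‖y - s • r.gy x y - r.yStar x‖ ≤ (1 - s * μ / 2) * ‖y - r.yStar x‖ := by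
  have h1 := h.mul_norm_sq_le_inner_gy hx y (r.yStar x)
  have h2 := h.norm_gy_sub_le hx y (r.yStar x)
  rw [h.gy_yStar hμ hx, sub_zero] at h1 h2
  rw [sub_right_comm]
  exact norm_sub_smul_le h1 h2 hs hsL hsμ

theorem norm_step_v_sub_le (h : r.Admissible X μ Lf0 Lf1 Lg1 Lg2 Q) (hμ : 0 < μ) (hLf0 : 0 ≤ Lf0)
    (hLg1 : 0 ≤ Lg1) {x : Vec d₁} (hx : x ∈ X) (y v : Vec d₂) {s : ℝ} (hs : 0 ≤ s)
    (hsL : s * Lg1 ^ 2 ≤ μ) (hsμ : s * μ ≤ 1) :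
    ‖projBall (Lf0 / μ) (v - s • r.dirV x y v) - r.vStar x‖ ≤
      (1 - s * μ / 2) * ‖v - r.vStar x‖ +
        s * (Lf1 + Lg2 * (Lf0 / μ)) * ‖y - r.yStar x‖ := by
  refine ((projBall_spec (by positivity) _).2 _ (h.norm_vStar_le hμ hLf0 hx)).trans ?_
  have h1 := norm_sub_smul_le (h.mul_norm_sq_le_inner_gyy hx y (v - r.vStar x))
    (ContinuousLinearMap.le_of_opNorm_le _ (h.norm_gyy_le hLg1 hx y) _) hs hsL hsμ
  have h2 : v - s • r.dirV x y v - r.vStar x = (v - r.vStar x - s • r.gyy x y (v - r.vStar x)) -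
      s • ((r.gyy x y - r.gyy x (r.yStar x)) (r.vStar x) -
        (r.fy x y - r.fy x (r.yStar x))) := by
    rw [sub_apply, h.gyy_vStar hμ hx, map_sub, dirV]
    module
  have h3 : ‖(r.gyy x y - r.gyy x (r.yStar x)) (r.vStar x) - (r.fy x y - r.fy x (r.yStar x))‖ ≤
      (Lf1 + Lg2 * (Lf0 / μ)) * ‖y - r.yStar x‖ := by
    have h4 := h.lip_gyy x hx x hx y (r.yStar x)
    have h5 := (norm_le_norm2_right _ _).trans (h.lip_grad_f x hx x hx y (r.yStar x))
    rw [sub_self, norm2_zero_left] at h4 h5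
    calc _ ≤ _ := norm_sub_le _ _
      _ ≤ Lg2 * ‖y - r.yStar x‖ * (Lf0 / μ) + Lf1 * ‖y - r.yStar x‖ := by
        gcongr
        refine (ContinuousLinearMap.le_opNorm_of_le _ (h.norm_vStar_le hμ hLf0 hx)).trans ?_
        gcongr
      _ = _ := by ring
  rw [h2]
  refine (norm_sub_le _ _).trans (add_le_add h1 ?_)
  rw [norm_smul, Real.norm_of_nonneg hs, mul_assoc]
  gcongr

/-- The bias of the hypergradient estimate is controlled by the two tracking errors. -/
theorem abs_inner_dirX_sub_hyperGrad_le (h : r.Admissible X μ Lf0 Lf1 Lg1 Lg2 Q) (hμ : 0 < μ)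
    (hLf0 : 0 ≤ Lf0) (hLf1 : 0 ≤ Lf1) (hLg1 : 0 ≤ Lg1) (hLg2 : 0 ≤ Lg2) (hc : Convex ℝ X)
    {x u u' : Vec d₁} (hx : x ∈ X) (hu : u ∈ X) (hu' : u' ∈ X) (y v : Vec d₂) :
    |inner ℝ (r.dirX x y v - r.hyperGrad x) (u - u')| ≤
      ((Lf1 + Lg2 * (Lf0 / μ)) * ‖y - r.yStar x‖ + Lg1 * ‖v - r.vStar x‖) * ‖u - u'‖ :=
  h.abs_inner_dirX_sub_le hc hLg1 hx hx hu hu' y _ v _ hLf1 hLg2 (h.norm_vStar_le hμ hLf0 hx)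
    (by rw [sub_self, norm2_zero_left]) le_rfl

/-- Decrease of the objective in one outer step; the bias enters only through its square times
`α`. -/
theorem F_proxStep_le (h : r.Admissible X μ Lf0 Lf1 Lg1 Lg2 Q) (hμ : 0 < μ)
    (hLf0 : 0 ≤ Lf0) (hLf1 : 0 ≤ Lf1) (hLg1 : 0 ≤ Lg1) (hLg2 : 0 ≤ Lg2) (hX : IsClosed X)
    (hc : Convex ℝ X) {x : Vec d₁} (hx : x ∈ X) (y v : Vec d₂) {α : ℝ} (hα : 0 < α)
    (hαL : α * lipF μ Lf0 Lf1 Lg1 Lg2 ≤ 1 / 2) :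
    r.F (proxStep X x (r.dirX x y v) α) ≤ r.F x -
      ‖proxStep X x (r.dirX x y v) α - x‖ ^ 2 / (2 * α) +
      α * ((Lf1 + Lg2 * (Lf0 / μ)) * ‖y - r.yStar x‖ + Lg1 * ‖v - r.vStar x‖) ^ 2 := by
  obtain ⟨hp, hvi⟩ := proxStep_spec hX hc hx (r.dirX x y v) hα
  set p := proxStep X x (r.dirX x y v) α
  set b := (Lf1 + Lg2 * (Lf0 / μ)) * ‖y - r.yStar x‖ + Lg1 * ‖v - r.vStar x‖
  have h1 := h.F_le hμ hLf0 hLf1 hLg1 hLg2 hc hx hp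
  have h2 := hvi x hx
  rw [← neg_sub p x, inner_neg_right, inner_add_left, inner_smul_left, real_inner_self_eq_norm_sq,
    conj_trivial] at h2
  have h3 := neg_le_of_abs_le
    (h.abs_inner_dirX_sub_hyperGrad_le hμ hLf0 hLf1 hLg1 hLg2 hc hx hp hx y v)
  rw [inner_sub_left] at h3
  set D := ‖p - x‖
  have h4 : r.F p * α ≤ (r.F x - D ^ 2 / (2 * α) + α * b ^ 2) * α := by
    have h5 : (r.F x - D ^ 2 / (2 * α) + α * b ^ 2) * α =
        r.F x * α - D ^ 2 / 2 + (α * b) ^ 2 := by field_simp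
    rw [h5]
    have h6 := mul_le_mul_of_nonneg_right h1 hα.le
    have h7 := mul_le_mul_of_nonneg_right h3 hα.le
    have h8 := mul_le_mul_of_nonneg_right hαL (sq_nonneg D)
    nlinarith [sq_nonneg (α * b - D / 2)]
  exact le_of_mul_le_mul_right h4 hα

theorem norm_gradMap_le (h : r.Admissible X μ Lf0 Lf1 Lg1 Lg2 Q) (hμ : 0 < μ)
    (hLf0 : 0 ≤ Lf0) (hLf1 : 0 ≤ Lf1) (hLg1 : 0 ≤ Lg1) (hLg2 : 0 ≤ Lg2) (hX : IsClosed X)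
    (hc : Convex ℝ X) {x : Vec d₁} (hx : x ∈ X) (y v : Vec d₂) {α : ℝ} (hα : 0 < α) :
    ‖gradMap X x (gradientWithin r.F X x) α‖ ≤ ‖proxStep X x (r.dirX x y v) α - x‖ / α +
      ((Lf1 + Lg2 * (Lf0 / μ)) * ‖y - r.yStar x‖ + Lg1 * ‖v - r.vStar x‖) := by
  have h1 := norm_proxStep_sub_le hX hc hx (G := r.dirX x y v) (G' := gradientWithin r.F X x) hα
    (b := (Lf1 + Lg2 * (Lf0 / μ)) * ‖y - r.yStar x‖ + Lg1 * ‖v - r.vStar x‖) (by positivity)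
    fun u hu u' hu' => by
      rw [inner_sub_left, h.inner_gradientWithin_F hμ hc hx hu hu', ← inner_sub_left]
      exact h.abs_inner_dirX_sub_hyperGrad_le hμ hLf0 hLf1 hLg1 hLg2 hc hx hu hu' y v
  rw [gradMap, norm_smul, Real.norm_of_nonneg (by positivity), one_div, inv_mul_eq_div,
    div_le_iff₀ hα, add_mul, div_mul_cancel₀ _ hα.ne']
  have h2 := norm_sub_le_norm_sub_add_norm_sub x (proxStep X x (r.dirX x y v) α)
    (proxStep X x (gradientWithin r.F X x) α)
  rw [norm_sub_rev x (proxStep X x (r.dirX x y v) α)] at h2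
  linarith

/-- The variation of `v*` between two rounds, at a common point. -/
theorem norm_vStar_sub_sq_le {r' : Round d₁ d₂} (h : r.Admissible X μ Lf0 Lf1 Lg1 Lg2 Q)
    (h' : r'.Admissible X μ Lf0 Lf1 Lg1 Lg2 Q) (hμ : 0 < μ) (hLf0 : 0 ≤ Lf0)
    {x : Vec d₁} (hx : x ∈ X) :
    ‖r.vStar x - r'.vStar x‖ ^ 2 ≤
      3 * ((Lf1 + Lg2 * (Lf0 / μ)) ^ 2 + (Lf0 / μ) ^ 2 + 1) / μ ^ 2 *
        (‖r.yStar x - r'.yStar x‖ ^ 2 + ‖r.gyy x (r.yStar x) - r'.gyy x (r.yStar x)‖ ^ 2 +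
          ‖r.fy x (r.yStar x) - r'.fy x (r.yStar x)‖ ^ 2) := by
  have h1 := h.mul_norm_vStar_sub_le h' hμ hLf0 hx hx
  have h2 := h'.lip_gyy x hx x hx (r.yStar x) (r'.yStar x)
  have h3 := (norm_le_norm2_right _ _).trans (h'.lip_grad_f x hx x hx (r.yStar x) (r'.yStar x))
  rw [sub_self, norm2_zero_left] at h2 h3
  have h4 := norm_sub_le_norm_sub_add_norm_sub (r.gyy x (r.yStar x)) (r'.gyy x (r.yStar x))
    (r'.gyy x (r'.yStar x))
  have h5 := norm_sub_le_norm_sub_add_norm_sub (r.fy x (r.yStar x)) (r'.fy x (r.yStar x))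
    (r'.fy x (r'.yStar x))
  have hp : 0 ≤ Lf0 / μ := by positivity
  set p := Lf0 / μ
  set M := Lf1 + Lg2 * p with hM
  set e := ‖r.yStar x - r'.yStar x‖
  set eg := ‖r.gyy x (r.yStar x) - r'.gyy x (r.yStar x)‖
  set ef := ‖r.fy x (r.yStar x) - r'.fy x (r.yStar x)‖
  have h6 : μ * ‖r.vStar x - r'.vStar x‖ ≤ M * e + p * eg + ef := by
    have := mul_le_mul_of_nonneg_right (h4.trans (add_le_add_right h2 eg)) hp
    rw [hM]
    linarith
  have h7 : (μ * ‖r.vStar x - r'.vStar x‖) ^ 2 ≤ (M * e + p * eg + ef) ^ 2 := by gcongr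
  have h8 : (M * e + p * eg + ef) ^ 2 ≤
      3 * (M ^ 2 + p ^ 2 + 1) * (e ^ 2 + eg ^ 2 + ef ^ 2) := by
    have h9 : (M * e + p * eg + ef) ^ 2 ≤ (M ^ 2 + p ^ 2 + 1) * (e ^ 2 + eg ^ 2 + ef ^ 2) := by
      nlinarith [sq_nonneg (M * eg - p * e), sq_nonneg (M * ef - e), sq_nonneg (p * ef - eg)]
    have : 0 ≤ (M ^ 2 + p ^ 2 + 1) * (e ^ 2 + eg ^ 2 + ef ^ 2) := by positivity
    linarith
  rw [div_mul_eq_mul_div, le_div_iff₀ (by positivity)]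
  linarith

end Round.Admissible

/-- Without noise the momentum corrections vanish: the correction `d - q` starts at `0` and is
multiplied by `1 - c` in each step, whatever the size of `c`. -/
theorem eq_of_momentum {E : Type*} [AddCommGroup E] [Module ℝ E] {d q : ℕ → E} {c : ℝ} {T : ℕ}
    (h1 : d 1 = q 1)
    (h : ∀ t ∈ Finset.Icc 2 T, d t = q t + (1 - c) • (d (t - 1) - q (t - 1))) :
    ∀ t ∈ Finset.Icc 1 T, d t = q t := by
  intro t ht
  obtain ⟨ht1, htT⟩ := Finset.mem_Icc.1 ht
  clear ht
  induction t, ht1 using Nat.le_induction with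
  | base => exact h1
  | succ n hn ih =>
    rw [h (n + 1) (Finset.mem_Icc.2 ⟨by omega, htT⟩), Nat.add_sub_cancel, ih (by omega), sub_self,
      smul_zero, add_zero]

end SOGD

/-! ### The regret of a run -/

namespace SOGD

open Finset

variable {d₁ d₂ : ℕ}

/-- A noise-free run is a plain simultaneous descent method: the momentum terms vanish. -/
theorem IsRun.step {X : Set (Vec d₁)} {p α β δ γ lam η : ℝ} {P : ℕ → Round d₁ d₂} {T : ℕ}
    {x : ℕ → Vec d₁} {y v : ℕ → Vec d₂} {dx : ℕ → Vec d₁} {dy dv : ℕ → Vec d₂}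
    (hrun : IsRun X p α β δ γ lam η P T x y v dx dy dv) {t : ℕ} (ht : t ∈ Icc 1 T) :
    y (t + 1) = y t - β • (P t).gy (x t) (y t) ∧
    v (t + 1) = projBall p (v t - δ • (P t).dirV (x t) (y t) (v t)) ∧
    x (t + 1) = proxStep X (x t) ((P t).dirX (x t) (y t) (v t)) α := by
  have h1 := eq_of_momentum (q := fun t => (P t).gy (x t) (y t)) hrun.dy_init hrun.dy_step t ht
  have h2 := eq_of_momentum (q := fun t => (P t).dirV (x t) (y t) (v t))
    hrun.dv_init hrun.dv_step t ht
  have h3 := eq_of_momentum (q := fun t => (P t).dirX (x t) (y t) (v t))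
    hrun.dx_init hrun.dx_step t ht
  refine ⟨?_, ?_, ?_⟩
  · rw [hrun.y_step t ht, h1]
  · rw [hrun.v_step t ht, h2]
  · rw [hrun.x_step t ht, h3]

theorem IsRun.x_mem {X : Set (Vec d₁)} (hX : IsClosed X) (hc : Convex ℝ X)
    {p α β δ γ lam η : ℝ} (hα : 0 < α) {P : ℕ → Round d₁ d₂} {T : ℕ}
    {x : ℕ → Vec d₁} {y v : ℕ → Vec d₂} {dx : ℕ → Vec d₁} {dy dv : ℕ → Vec d₂}
    (hrun : IsRun X p α β δ γ lam η P T x y v dx dy dv) :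
    ∀ t ∈ Icc 1 (T + 1), x t ∈ X := by
  intro t ht
  obtain ⟨ht1, htT⟩ := mem_Icc.1 ht
  clear ht
  induction t, ht1 using Nat.le_induction with
  | base => exact hrun.x_init
  | succ n hn ih =>
    rw [hrun.x_step n (mem_Icc.2 ⟨hn, by omega⟩)]
    exact (proxStep_spec hX hc (ih (by omega)) _ hα).1

/-- The regret bound with the variations evaluated along the run only. -/
theorem exists_regret_le {μ Lf0 Lf1 Lg1 Lg2 : ℝ} (hμ : 0 < μ)
    (hLf0 : 0 ≤ Lf0) (hLf1 : 0 ≤ Lf1) (hLg1 : 0 ≤ Lg1) (hLg2 : 0 ≤ Lg2) :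
    ∃ κ > (0 : ℝ), ∃ c₀ > (0 : ℝ), ∀ α > (0 : ℝ), c₀ * α ≤ 1 → ∀ Q ≥ (0 : ℝ), ∀ R ≥ (0 : ℝ),
      ∃ C > (0 : ℝ), ∀ (d₁ d₂ : ℕ) (X : Set (Vec d₁)), IsClosed X → Convex ℝ X →
        ∀ (T : ℕ) (P : ℕ → Round d₁ d₂),
          (∀ t ∈ Icc 1 T, (P t).Admissible X μ Lf0 Lf1 Lg1 Lg2 Q) →
        ∀ (x : ℕ → Vec d₁) (y v : ℕ → Vec d₂) (dx : ℕ → Vec d₁) (dy dv : ℕ → Vec d₂)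
          (γ lam η : ℝ),
          IsRun X (Lf0 / μ) α (κ * α) (κ * α) γ lam η P T x y v dx dy dv →
          ‖y 1 - (P 1).yStar (x 1)‖ ≤ R → ‖v 1‖ ≤ R →
          regret X P T x α ≤ C * (1 + ∑ t ∈ Icc 2 T, |(P (t - 1)).F (x t) - (P t).F (x t)| +
            ∑ t ∈ Icc 2 T, ‖(P (t - 1)).yStar (x t) - (P t).yStar (x t)‖ ^ 2 +
            (∑ t ∈ Icc 2 T, ‖(P (t - 1)).gyy (x t) ((P (t - 1)).yStar (x t)) -
                (P t).gyy (x t) ((P (t - 1)).yStar (x t))‖ ^ 2 +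
              ∑ t ∈ Icc 2 T, ‖(P (t - 1)).fy (x t) ((P (t - 1)).yStar (x t)) -
                (P t).fy (x t) ((P (t - 1)).yStar (x t))‖ ^ 2)) := by
  obtain ⟨κ, hκ, hmain⟩ := exists_ratio_sum_sq_le (m := μ / 2) (l := Lg1 / μ)
    (M := Lf1 + Lg2 * (Lf0 / μ)) (lv := (Lf1 + Lg2 * (Lf0 / μ)) * (1 + Lg1 / μ) / μ)
    (A := Lf1 + Lg2 * (Lf0 / μ)) (B := Lg1) (half_pos hμ)
  have hLF : 0 ≤ Round.Admissible.lipF μ Lf0 Lf1 Lg1 Lg2 := by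
    unfold Round.Admissible.lipF
    positivity
  -- the three summands make the inner steps stable and the outer step short enough for descent
  refine ⟨κ, hκ, κ * Lg1 ^ 2 / μ + κ * μ + 2 * Round.Admissible.lipF μ Lf0 Lf1 Lg1 Lg2,
    by positivity, fun α hα hcα Q hQ R hR => ?_⟩
  have hs : 0 ≤ κ * α := by positivity
  have e1 : 0 ≤ κ * Lg1 ^ 2 / μ * α := by positivity
  have e2 : 0 ≤ κ * μ * α := by positivity
  have e3 : 0 ≤ 2 * Round.Admissible.lipF μ Lf0 Lf1 Lg1 Lg2 * α := by positivity
  rw [add_mul, add_mul] at hcα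
  have hsμ : κ * α * μ ≤ 1 := by linarith
  have hsL : κ * α * Lg1 ^ 2 ≤ μ := by
    have h1 : κ * Lg1 ^ 2 / μ * α ≤ 1 := by linarith
    rw [div_mul_eq_mul_div, div_le_one hμ] at h1
    linarith
  have hαL : α * Round.Admissible.lipF μ Lf0 Lf1 Lg1 Lg2 ≤ 1 / 2 := by linarith
  obtain ⟨C, hC, hmain⟩ := hmain α hα (by linarith) Q hQ (R + Lf0 / μ) (by positivity)
  obtain ⟨Ck, hCk⟩ : ∃ c, c = 3 * ((Lf1 + Lg2 * (Lf0 / μ)) ^ 2 + (Lf0 / μ) ^ 2 + 1) / μ ^ 2 :=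
    ⟨_, rfl⟩
  have hCk0 : 0 < Ck := by rw [hCk]; positivity
  refine ⟨C * (1 + Ck), by positivity, ?_⟩
  intro d₁ d₂ X hX hc T P hP x y v dx dy dv γ lam η hrun hy1 hv1
  rcases Nat.eq_zero_or_pos T with rfl | hT
  · simp [regret]
    positivity
  have hone : 1 ∈ Icc 1 T := mem_Icc.2 ⟨le_rfl, hT⟩
  have hx : ∀ t ∈ Icc 1 T, x t ∈ X := fun t ht =>
    hrun.x_mem hX hc hα t (Icc_subset_Icc_right T.le_succ ht)
  have hx' : ∀ t ∈ Icc 1 T, x (t + 1) ∈ X := fun t ht => by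
    have := mem_Icc.1 ht
    exact hrun.x_mem hX hc hα (t + 1) (mem_Icc.2 ⟨by omega, by omega⟩)
  have hbound := hmain T (fun t => ‖y t - (P t).yStar (x t)‖) (fun t => ‖v t - (P t).vStar (x t)‖)
    (fun t => ‖x (t + 1) - x t‖)
    (fun t => ‖gradMap X (x t) (gradientWithin (P t).F X (x t)) α‖)
    (fun t => ‖(P (t - 1)).yStar (x t) - (P t).yStar (x t)‖)
    (fun t => ‖(P (t - 1)).vStar (x t) - (P t).vStar (x t)‖)
    (fun t => |(P (t - 1)).F (x t) - (P t).F (x t)|)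
    (fun t => (P t).F (x t)) (fun t => (P t).F (x (t + 1)))
    (fun t => norm_nonneg _) (fun t => norm_nonneg _) (fun t => abs_nonneg _)
    (fun t => norm_nonneg _)
    (hy1.trans (by linarith [show 0 ≤ Lf0 / μ by positivity]))
    ((norm_sub_le _ _).trans (add_le_add hv1 ((hP 1 hone).norm_vStar_le hμ hLf0 (hx 1 hone))))
    (fun t ht => (hP t ht).bounded_F _ (hx t ht))
    (fun t ht => (hP t ht).bounded_F _ (hx' t ht))
    (fun t ht => by
      have := mem_Icc.1 ht
      simp only [Nat.sub_add_cancel (show 1 ≤ t by omega)]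
      rw [abs_sub_comm]
      exact le_abs_self _)
    (fun t ht => by
      obtain ⟨ht1, ht2⟩ := mem_Icc.1 ht
      obtain ⟨s, rfl⟩ : ∃ s, t = s + 1 := ⟨t - 1, by omega⟩
      have hs1 : s ∈ Icc 1 T := mem_Icc.2 ⟨by omega, by omega⟩
      simp only [Nat.add_sub_cancel]
      have h1 := (hP s hs1).norm_step_y_sub_le hμ (hx s hs1) (y s) hs hsL hsμ
      rw [← (hrun.step hs1).1] at h1
      have h2 := (hP s hs1).norm_yStar_sub_le hμ (hx' s hs1) (hx s hs1)
      have h3 := norm_sub_le_norm_sub_add_norm_sub (y (s + 1)) ((P s).yStar (x s))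
        ((P (s + 1)).yStar (x (s + 1)))
      have h4 := norm_sub_le_norm_sub_add_norm_sub ((P s).yStar (x s)) ((P s).yStar (x (s + 1)))
        ((P (s + 1)).yStar (x (s + 1)))
      rw [norm_sub_rev ((P s).yStar (x s)) ((P s).yStar (x (s + 1)))] at h4
      linarith)
    (fun t ht => by
      obtain ⟨ht1, ht2⟩ := mem_Icc.1 ht
      obtain ⟨s, rfl⟩ : ∃ s, t = s + 1 := ⟨t - 1, by omega⟩
      have hs1 : s ∈ Icc 1 T := mem_Icc.2 ⟨by omega, by omega⟩
      simp only [Nat.add_sub_cancel]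
      have h1 := (hP s hs1).norm_step_v_sub_le hμ hLf0 hLg1 (hx s hs1) (y s) (v s) hs hsL hsμ
      rw [← (hrun.step hs1).2.1] at h1
      have h2 := (hP s hs1).norm_vStar_sub_le hμ hLf0 hLf1 hLg2 (hx' s hs1) (hx s hs1)
      have h3 := norm_sub_le_norm_sub_add_norm_sub (v (s + 1)) ((P s).vStar (x s))
        ((P (s + 1)).vStar (x (s + 1)))
      have h4 := norm_sub_le_norm_sub_add_norm_sub ((P s).vStar (x s)) ((P s).vStar (x (s + 1)))
        ((P (s + 1)).vStar (x (s + 1)))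
      rw [norm_sub_rev ((P s).vStar (x s)) ((P s).vStar (x (s + 1)))] at h4
      linarith)
    (fun t ht => by
      simp only [(hrun.step ht).2.2]
      exact (hP t ht).F_proxStep_le hμ hLf0 hLf1 hLg1 hLg2 hX hc (hx t ht) _ _ hα hαL)
    (fun t ht => by
      simp only [(hrun.step ht).2.2]
      exact (hP t ht).norm_gradMap_le hμ hLf0 hLf1 hLg1 hLg2 hX hc (hx t ht) _ _ hα)
  have hk : ∑ t ∈ Icc 2 T, ‖(P (t - 1)).vStar (x t) - (P t).vStar (x t)‖ ^ 2 ≤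
      Ck * (∑ t ∈ Icc 2 T, ‖(P (t - 1)).yStar (x t) - (P t).yStar (x t)‖ ^ 2 +
        ∑ t ∈ Icc 2 T, ‖(P (t - 1)).gyy (x t) ((P (t - 1)).yStar (x t)) -
          (P t).gyy (x t) ((P (t - 1)).yStar (x t))‖ ^ 2 +
        ∑ t ∈ Icc 2 T, ‖(P (t - 1)).fy (x t) ((P (t - 1)).yStar (x t)) -
          (P t).fy (x t) ((P (t - 1)).yStar (x t))‖ ^ 2) := by
    rw [← sum_add_distrib, ← sum_add_distrib, mul_sum]
    refine sum_le_sum fun t ht => ?_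
    have ht' := mem_Icc.1 ht
    have h1 : t ∈ Icc 1 T := mem_Icc.2 ⟨by omega, by omega⟩
    have h2 : t - 1 ∈ Icc 1 T := mem_Icc.2 ⟨by omega, by omega⟩
    rw [hCk]
    exact (hP _ h2).norm_vStar_sub_sq_le (hP t h1) hμ hLf0 (hx t h1)
  refine hbound.trans ?_
  rw [mul_assoc]
  refine mul_le_mul_of_nonneg_left ?_ hC.le
  have hV : 0 ≤ ∑ t ∈ Icc 2 T, |(P (t - 1)).F (x t) - (P t).F (x t)| :=
    sum_nonneg fun t _ => abs_nonneg _
  have hH : 0 ≤ ∑ t ∈ Icc 2 T, ‖(P (t - 1)).gyy (x t) ((P (t - 1)).yStar (x t)) -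
      (P t).gyy (x t) ((P (t - 1)).yStar (x t))‖ ^ 2 := sum_nonneg fun t _ => sq_nonneg _
  have hE : 0 ≤ ∑ t ∈ Icc 2 T, ‖(P (t - 1)).fy (x t) ((P (t - 1)).yStar (x t)) -
      (P t).fy (x t) ((P (t - 1)).yStar (x t))‖ ^ 2 := sum_nonneg fun t _ => sq_nonneg _
  have := mul_nonneg hCk0.le hV
  linarith

/-- A sum of values of a family at points of a set is bounded by the sum of the suprema. -/
theorem ofReal_sum_le_sum {s : Finset ℕ} {u : ℕ → ℝ} {w : ℕ → ℝ≥0∞} (hu : ∀ t, 0 ≤ u t)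
    (h : ∀ t ∈ s, ENNReal.ofReal (u t) ≤ w t) :
    ENNReal.ofReal (∑ t ∈ s, u t) ≤ ∑ t ∈ s, w t := by
  rw [ENNReal.ofReal_sum_of_nonneg fun t _ => hu t]
  exact sum_le_sum h

end SOGD

theorem theorem8 (μg Lf0 Lf1 Lg1 Lg2 : ℝ) (hμ : 0 < μg)
    (hLf0 : 0 ≤ Lf0) (hLf1 : 0 ≤ Lf1) (hLg1 : 0 ≤ Lg1) (hLg2 : 0 ≤ Lg2) :
    ∃ cβ > (0 : ℝ), ∃ cδ > (0 : ℝ), ∃ c₀ > (0 : ℝ),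
      ∀ cγ > (0 : ℝ), ∀ clam > (0 : ℝ), ∀ cη > (0 : ℝ), ∀ c ≥ c₀, ∀ α : ℝ, α = 1 / c →
      ∀ Q > (0 : ℝ), ∀ R ≥ (0 : ℝ), ∃ C > (0 : ℝ),
        ∀ (d₁ d₂ : ℕ) (X : Set (SOGD.Vec d₁)), IsClosed X → Convex ℝ X →
        ∀ (T : ℕ) (P : ℕ → SOGD.Round d₁ d₂),
          (∀ t ∈ Finset.Icc 1 T, (P t).Admissible X μg Lf0 Lf1 Lg1 Lg2 Q) →
        ∀ (x : ℕ → SOGD.Vec d₁) (y v : ℕ → SOGD.Vec d₂)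
          (dx : ℕ → SOGD.Vec d₁) (dy dv : ℕ → SOGD.Vec d₂),
          SOGD.IsRun X (Lf0 / μg) α (cβ * α) (cδ * α) (cγ * α ^ 2) (clam * α ^ 2) (cη * α ^ 2)
            P T x y v dx dy dv →
          ‖y 1 - (P 1).yStar (x 1)‖ ≤ R → ‖v 1‖ ≤ R →
          (∀ t ∈ Finset.Icc 1 T, ∀ z ∈ X, DifferentiableWithinAt ℝ (P t).F X z) ∧
          ENNReal.ofReal (SOGD.regret X P T x α) ≤ ENNReal.ofReal C *
            (1 + SOGD.varV X P T + SOGD.varH2 X P T + SOGD.varE2 X P T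
              + SOGD.varP X P T x y) := by
  obtain ⟨κ, hκ, c₀, hc₀, hmain⟩ := SOGD.exists_regret_le hμ hLf0 hLf1 hLg1 hLg2
  refine ⟨κ, hκ, κ, hκ, c₀, hc₀, fun cγ _ clam _ cη _ c hc α hα Q hQ R hR => ?_⟩
  have hcpos : 0 < c := hc₀.trans_le hc
  have hα0 : 0 < α := by rw [hα]; positivity
  obtain ⟨C, hC, hreg⟩ := hmain α hα0 (by rwa [hα, mul_one_div, div_le_one hcpos]) Q hQ.le R hR
  refine ⟨C, hC, fun d₁ d₂ X hX hcv T P hP x y v dx dy dv hrun hy1 hv1 =>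
    ⟨fun t ht z hz => ((hP t ht).hasGradientWithinAt_F hμ hz).differentiableWithinAt, ?_⟩⟩
  have hx : ∀ t ∈ Finset.Icc 2 T, x t ∈ X := fun t ht => by
    have := Finset.mem_Icc.1 ht
    exact hrun.x_mem hX hcv hα0 t (Finset.mem_Icc.2 ⟨by omega, by omega⟩)
  have hsq : ∀ {E : Type} [NormedAddCommGroup E] (e : E), ENNReal.ofReal (‖e‖ ^ 2) = ‖e‖ₑ ^ 2 :=
    fun e => by rw [ENNReal.ofReal_pow (norm_nonneg _), ofReal_norm]
  refine (ENNReal.ofReal_le_ofReal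
    (hreg d₁ d₂ X hX hcv T P hP x y v dx dy dv _ _ _ hrun hy1 hv1)).trans ?_
  rw [ENNReal.ofReal_mul hC.le]
  gcongr
  refine le_trans ?_ le_self_add
  refine ENNReal.ofReal_add_le.trans (add_le_add (ENNReal.ofReal_add_le.trans
    (add_le_add (ENNReal.ofReal_add_le.trans (add_le_add ENNReal.ofReal_one.le ?_)) ?_))
    (ENNReal.ofReal_add_le.trans (add_le_add ?_ ?_)))
  · refine SOGD.ofReal_sum_le_sum (fun t => abs_nonneg _) fun t ht => ?_
    rw [← Real.enorm_eq_ofReal_abs]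
    exact le_iSup₂_of_le (x t) (hx t ht) le_rfl
  · refine SOGD.ofReal_sum_le_sum (fun t => sq_nonneg _) fun t ht => ?_
    rw [hsq]
    exact le_iSup₂_of_le (x t) (hx t ht) le_rfl
  · refine SOGD.ofReal_sum_le_sum (fun t => sq_nonneg _) fun t ht => ?_
    rw [hsq]
    exact le_iSup₂_of_le (x t) (hx t ht) (le_iSup_of_le _ le_rfl)
  · refine SOGD.ofReal_sum_le_sum (fun t => sq_nonneg _) fun t ht => ?_
    rw [hsq]
    exact le_iSup₂_of_le (x t) (hx t ht) (le_iSup_of_le _ le_rfl)
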